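/- Let $d\ge 1$ and let finitely many classes be given, class $i$ having selection probability $\alpha_i\ge 0$, $\sum_i\alpha_i=1$, and class-conditional probability density $p_i$ on $\mathbb{R}^d$; every $p_i$ is Lipschitz continuous, bounded and twice differentiable. Data points ${\bf X}_1,{\bf X}_2,\dots$ with labels are drawn independently: a class $i$ is selected with probability $\alpha_i$, and the point is then drawn from $p_i$. Fix a class $A$ with $0<\alpha_A<1$ and put $$\alpha_{A^c}=1-\alpha_A,\qquad p_{A^c}=\frac{1}{\alpha_{A^c}}\sum_{i\ne A}\alpha_i p_i,\qquad p=\alpha_A p_A+\alpha_{A^c}p_{A^c},\qquad \partial A=\{x\in\mathbb{R}^d : p_A(x)\,p_{A^c}(x)>0\}.$$ For $n\in\mathbb{N}$ and $\sigma>0$ let ${\bf W}$ be the $n\times n$ matrix with $w_{ii}=0$ and $w_{ij}=(2\pi\sigma^2)^{-d/2}e^{-\|{\bf X}_i-{\bf X}_j\|^2/(2\sigma^2)}$ for $i\ne j$, let ${\bf D}$ be the diagonal matrix with ${\bf D}_{ii}=\sum_j w_{ij}$, and let ${\bf L}=\frac1n({\bf D}-{\bf W})$. Let ${\bf 1}_A\in\{0,1\}^n$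 be the vector whose $i$-th entry is $1$ exactly when ${\bf X}_i$ is drawn from class $A$, and let $$\omega_m({\bf 1}_A)=\left(\frac{{\bf 1}_A^T{\bf L}^m{\bf 1}_A}{{\bf 1}_A^T{\bf 1}_A}\right)^{1/m}$$ (read as $0$ if ${\bf 1}_A=0$). If $n\to\infty$, $\sigma\to0$ (with $\sigma>0$) and $m\to\infty$ in such a way that $$\frac{n\,\sigma^{md}}{m^2C^m}\to\infty\quad\text{with } C=\frac{2}{(2\pi)^{d/2}},\qquad\text{and}\qquad m\,2^m\sigma^2\to0,$$ then $$\omega_m({\bf 1}_A)\to\sup_{x\in\partial A}p(x)\quad\text{in probability},$$ where the supremum is read as $0$ if $\partial A=\emptyset$. -/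

import Mathlib

open MeasureTheory ProbabilityTheory Filter Topology
open scoped Matrix

noncomputable section

/-- A probability density on `ℝ^d` (with respect to Lebesgue measure) that is Lipschitz continuous,
bounded from above and twice differentiable. -/
structure IsRegularDensity {d : ℕ} (f : EuclideanSpace ℝ (Fin d) → ℝ) : Prop where
  nonneg : ∀ x, 0 ≤ f x
  integrable : Integrable f volume
  integral_eq_one : ∫ x, f x = 1
  lipschitz : ∃ K, LipschitzWith K f
  bounded : ∃ B : ℝ, ∀ x, f x ≤ B
  differentiable : Differentiable ℝ f
  differentiable_fderiv : Differentiable ℝ (fderiv ℝ f)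

section Model

variable {d : ℕ} {ι : Type*} [Fintype ι]

/-- The joint law of one feature vector and its class label: class `i` is selected with
probability `α i`, and the feature vector is then drawn from the density `f i`. -/
def labelledMixture [MeasurableSpace ι] (α : ι → ℝ) (f : ι → EuclideanSpace ℝ (Fin d) → ℝ) :
    Measure (EuclideanSpace ℝ (Fin d) × ι) :=
  ∑ i, ENNReal.ofReal (α i) •
    (volume.withDensity fun x => ENNReal.ofReal (f i x)).prod (Measure.dirac i)

variable [DecidableEq ι]

/-- The density `p_{A^c} = (∑_{i ≠ A} α_i p_i) / α_{A^c}`, where `α_{A^c} = 1 - α_A`, of the points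
that do not belong to the class `A`. -/
def complDensity (α : ι → ℝ) (f : ι → EuclideanSpace ℝ (Fin d) → ℝ) (A : ι)
    (x : EuclideanSpace ℝ (Fin d)) : ℝ :=
  (∑ i ∈ Finset.univ.erase A, α i * f i x) / (1 - α A)

/-- The marginal density `p = α_A p_A + α_{A^c} p_{A^c}` of the data points. -/
def mixtureDensity (α : ι → ℝ) (f : ι → EuclideanSpace ℝ (Fin d) → ℝ) (A : ι)
    (x : EuclideanSpace ℝ (Fin d)) : ℝ :=
  α A * f A x + (1 - α A) * complDensity α f A x

/-- The overlap region `∂A = {x | p_A(x) p_{A^c}(x) > 0}` of the class `A`. -/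
def overlapRegion (α : ι → ℝ) (f : ι → EuclideanSpace ℝ (Fin d) → ℝ) (A : ι) :
    Set (EuclideanSpace ℝ (Fin d)) :=
  {x | 0 < f A x * complDensity α f A x}

end Model

section Graph

variable {d n : ℕ}

/-- The Gaussian kernel `K_{σ²}(x, y) = (2πσ²)^{-d/2} exp(-‖x - y‖² / (2σ²))` on `ℝ^d`. -/
def gaussianKernel (σ : ℝ) (x y : EuclideanSpace ℝ (Fin d)) : ℝ :=
  1 / (2 * Real.pi * σ ^ 2) ^ ((d : ℝ) / 2) * Real.exp (-‖x - y‖ ^ 2 / (2 * σ ^ 2))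

/-- The adjacency matrix `W` of the similarity graph on the points `x`, without self-loops. -/
def weightMatrix (σ : ℝ) (x : Fin n → EuclideanSpace ℝ (Fin d)) : Matrix (Fin n) (Fin n) ℝ :=
  Matrix.of fun i j => if i = j then 0 else gaussianKernel σ (x i) (x j)

/-- The degree matrix `D`. -/
def degreeMatrix (σ : ℝ) (x : Fin n → EuclideanSpace ℝ (Fin d)) : Matrix (Fin n) (Fin n) ℝ :=
  Matrix.diagonal fun i => ∑ j, weightMatrix σ x i j

/-- The graph Laplacian `L = (1/n) (D - W)`. -/
def graphLaplacian (σ : ℝ) (x : Fin n → EuclideanSpace ℝ (Fin d)) : Matrix (Fin n) (Fin n) ℝ :=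
  (1 / (n : ℝ)) • (degreeMatrix σ x - weightMatrix σ x)

/-- The bandwidth estimate `ω_m(g) = (gᵀ L^m g / gᵀ g)^{1/m}` of order `m`. -/
def bandwidthEstimate (L : Matrix (Fin n) (Fin n) ℝ) (m : ℕ) (g : Fin n → ℝ) : ℝ :=
  ((g ⬝ᵥ ((L ^ m) *ᵥ g)) / (g ⬝ᵥ g)) ^ (1 / (m : ℝ))

/-- The indicator vector of the class `A` for the labels `y`. -/
def classIndicator {ι : Type*} [DecidableEq ι] (A : ι) (y : Fin n → ι) : Fin n → ℝ :=
  fun i => if y i = A then 1 else 0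

end Graph

/-- The constant `C = 2 / (2π)^{d/2}`. -/
def rateConst (d : ℕ) : ℝ := 2 / (2 * Real.pi) ^ ((d : ℝ) / 2)

end

/-!
The Laplacian `L` is positive semidefinite, and so is the Gaussian kernel: it is an integral of
products `φ(x - z) φ(y - z)`. Hence `L ≤ D / n + (2πσ²)^{-d/2} / n`, without the factor `2` lost for
general weights (`dotProduct_graphLaplacian_le`). The first rate forces `n ≥ (2 (2πσ²)^{-d/2})^m`, so
Hoeffding's inequality conditional on one data point, with a union bound, shows that for bounded `φ`
the averages `n⁻¹ ∑_j w_ij φ(X_j, Y_j)` are uniformly close to `∑_c α_c p_c(x) φ(x, c)` at `x = X_i`,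
as soon as this limit is Lipschitz (`tendsto_measure_exists_lt_abs_weighted_average_sub`). Write `s`
for the supremum of `p` over the overlap region and `g` for the indicator of the class `A`.

Upper bound (`bandwidthEstimate_le`). If two points of opposite classes are within distance `r`, the
segment between them contains a point of the overlap region or a zero of `p`, so `p ≤ s + K r` at
both, with `K` a Lipschitz constant of `p`. Drop the weights at distance more than `r = √σ`; call the
resulting Laplacian `L'`. Then `L' g` lives on such points and each further application of `L'`
spreads the support by `r`. So all `L'^k g` with `1 ≤ k ≤ m` live where `p ≤ s + K m r`, where the
degrees are at most `s + o(1)`, and `‖L'^m g‖ ≤ (s + o(1))^m ‖g‖`. The second rate makes `m` at most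
logarithmic in `1 / σ`; therefore `m r → 0`, and the cost of truncation, of order
`m (2 (2πσ²)^{-d/2})^m e^{-1/(2σ)}`, is below `ε^m` for every `ε > 0`.

Lower bound (`le_bandwidthEstimate`). The moments `gᵀ L^k g` are log-convex in `k`, so the estimate
increases with its order and a fixed order `M ≤ m` may be used. With `a = α_A p_A / p`, averaging over
neighbours sends `p^k (g - a)` to `0`, since `a` is the conditional mean of `g`. By induction `L^k g`
is close to `p^k (g - a)`, and by the law of large numbers `gᵀ L^M g / n` is close to
`∫ p^M (1 - a) α_A p_A ≥ c t'^M` for `t' < s`, where `c > 0` is the integral of `(1 - a) α_A p_A`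
over `{p > t'}`. For `M` large the constant `c` is harmless.

Smoothing by the Gaussian kernel moves a Lipschitz function by `O(σ)` only, which controls the bias
of the averages (`abs_integral_gaussianKernel_mul_sub_le`).
-/

/-! ### Positive semidefinite matrices -/

section LinearAlgebra

variable {V : Type*} [Fintype V]

theorem norm_toLp_sq (v : V → ℝ) : ‖WithLp.toLp 2 v‖ ^ 2 = v ⬝ᵥ v := by
  rw [EuclideanSpace.real_norm_sq_eq]
  simp [dotProduct, pow_two]

theorem abs_dotProduct_le_norm_mul_norm (u v : V → ℝ) :
    |u ⬝ᵥ v| ≤ ‖WithLp.toLp 2 u‖ * ‖WithLp.toLp 2 v‖ := by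
  have h := abs_real_inner_le_norm (WithLp.toLp 2 v) (WithLp.toLp 2 u)
  rw [EuclideanSpace.inner_toLp_toLp] at h
  simpa [mul_comm] using h

theorem Matrix.PosSemidef.dotProduct_mulVec_comm {M : Matrix V V ℝ} (hM : M.PosSemidef)
    (u v : V → ℝ) : u ⬝ᵥ M *ᵥ v = v ⬝ᵥ M *ᵥ u := by
  have h : Mᵀ = M := by simpa [Matrix.IsHermitian] using hM.1
  rw [Matrix.dotProduct_mulVec, ← Matrix.mulVec_transpose, h, dotProduct_comm]

theorem Matrix.PosSemidef.dotProduct_mulVec_self_nonneg {M : Matrix V V ℝ} (hM : M.PosSemidef)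
    (v : V → ℝ) : 0 ≤ v ⬝ᵥ M *ᵥ v := by
  simpa using hM.dotProduct_mulVec_nonneg v

/-- The Cauchy–Schwarz inequality for the form of a positive semidefinite matrix. -/
theorem Matrix.PosSemidef.sq_dotProduct_mulVec_le {M : Matrix V V ℝ} (hM : M.PosSemidef)
    (u v : V → ℝ) : (u ⬝ᵥ M *ᵥ v) ^ 2 ≤ (u ⬝ᵥ M *ᵥ u) * (v ⬝ᵥ M *ᵥ v) := by
  have h : ∀ t : ℝ, 0 ≤ (v ⬝ᵥ M *ᵥ v) * (t * t) + (2 * (u ⬝ᵥ M *ᵥ v)) * t + u ⬝ᵥ M *ᵥ u := by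
    intro t
    have h1 := hM.dotProduct_mulVec_self_nonneg (u + t • v)
    simp only [Matrix.mulVec_add, Matrix.mulVec_smul, dotProduct_add, add_dotProduct,
      smul_dotProduct, dotProduct_smul, smul_eq_mul, hM.dotProduct_mulVec_comm v u] at h1
    linarith
  have h2 := discrim_le_zero h
  simp only [discrim] at h2
  linarith

/-- If `M *ᵥ v` pairs with itself as it does with the image of a vector `v'`, and the form of `M`
is at most `θ` times the norm squared at both vectors, then `M *ᵥ v` has norm at most `θ ‖v'‖`. No
bound on `M` at vectors other than these two is needed. -/
theorem Matrix.PosSemidef.norm_mulVec_le {M : Matrix V V ℝ} (hM : M.PosSemidef) {θ : ℝ}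
    (hθ : 0 ≤ θ) {u v : V → ℝ} (huv : u ⬝ᵥ u = u ⬝ᵥ M *ᵥ v)
    (hu : u ⬝ᵥ M *ᵥ u ≤ θ * (u ⬝ᵥ u)) (hv : v ⬝ᵥ M *ᵥ v ≤ θ * (v ⬝ᵥ v)) :
    ‖WithLp.toLp 2 u‖ ≤ θ * ‖WithLp.toLp 2 v‖ := by
  have h := hM.sq_dotProduct_mulVec_le u v
  rw [← huv] at h
  rw [← norm_toLp_sq] at h hu
  rw [← norm_toLp_sq] at hv
  set a := ‖WithLp.toLp 2 u‖
  set b := ‖WithLp.toLp 2 v‖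
  have ha : 0 ≤ a := norm_nonneg _
  have hb : 0 ≤ b := norm_nonneg _
  rcases ha.eq_or_lt with h0 | h0
  · rw [← h0]; positivity
  have h1 : (a ^ 2) ^ 2 ≤ (θ * a ^ 2) * (θ * b ^ 2) :=
    h.trans (mul_le_mul hu hv (hM.dotProduct_mulVec_self_nonneg v) (by positivity))
  have h2 : a ^ 2 ≤ (θ * b) ^ 2 := by
    have : 0 < a ^ 2 := by positivity
    nlinarith
  exact (pow_le_pow_iff_left₀ ha (by positivity) two_ne_zero).1 h2

theorem Matrix.PosSemidef.norm_mulVec_le_of_forall {M : Matrix V V ℝ} (hM : M.PosSemidef) {θ : ℝ}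
    (hθ : 0 ≤ θ) (h : ∀ v, v ⬝ᵥ M *ᵥ v ≤ θ * (v ⬝ᵥ v)) (v : V → ℝ) :
    ‖WithLp.toLp 2 (M *ᵥ v)‖ ≤ θ * ‖WithLp.toLp 2 v‖ :=
  hM.norm_mulVec_le hθ rfl (h _) (h _)

variable [DecidableEq V]

theorem norm_pow_mulVec_le {M : Matrix V V ℝ} {B : ℝ} (hB : 0 ≤ B)
    (hM : ∀ v, ‖WithLp.toLp 2 (M *ᵥ v)‖ ≤ B * ‖WithLp.toLp 2 v‖) (g : V → ℝ) (k : ℕ) :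
    ‖WithLp.toLp 2 ((M ^ k) *ᵥ g)‖ ≤ B ^ k * ‖WithLp.toLp 2 g‖ := by
  induction k with
  | zero => simp
  | succ k ih =>
    rw [pow_succ' M, ← Matrix.mulVec_mulVec]
    calc _ ≤ B * ‖WithLp.toLp 2 ((M ^ k) *ᵥ g)‖ := hM _
      _ ≤ B * (B ^ k * ‖WithLp.toLp 2 g‖) := by gcongr
      _ = _ := by ring

theorem norm_pow_mulVec_sub_le {M N : Matrix V V ℝ} {B η : ℝ} (hB : 0 ≤ B) (hη : 0 ≤ η)
    (hM : ∀ v, ‖WithLp.toLp 2 (M *ᵥ v)‖ ≤ B * ‖WithLp.toLp 2 v‖)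
    (hN : ∀ v, ‖WithLp.toLp 2 (N *ᵥ v)‖ ≤ B * ‖WithLp.toLp 2 v‖)
    (hMN : ∀ v, ‖WithLp.toLp 2 ((M - N) *ᵥ v)‖ ≤ η * ‖WithLp.toLp 2 v‖) (g : V → ℝ) (k : ℕ) :
    ‖WithLp.toLp 2 ((M ^ (k + 1)) *ᵥ g - (N ^ (k + 1)) *ᵥ g)‖
      ≤ (k + 1) * B ^ k * η * ‖WithLp.toLp 2 g‖ := by
  induction k with
  | zero => simpa [Matrix.sub_mulVec] using hMN g
  | succ k ih =>
    have h : (M ^ (k + 1 + 1)) *ᵥ g - (N ^ (k + 1 + 1)) *ᵥ g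
        = M *ᵥ ((M ^ (k + 1)) *ᵥ g - (N ^ (k + 1)) *ᵥ g) + (M - N) *ᵥ ((N ^ (k + 1)) *ᵥ g) := by
      rw [pow_succ' M (k + 1), pow_succ' N (k + 1), ← Matrix.mulVec_mulVec, ← Matrix.mulVec_mulVec,
        Matrix.mulVec_sub, Matrix.sub_mulVec]
      abel
    rw [h, WithLp.toLp_add]
    refine (norm_add_le _ _).trans ?_
    have h1 := (hM ((M ^ (k + 1)) *ᵥ g - (N ^ (k + 1)) *ᵥ g)).trans
      (mul_le_mul_of_nonneg_left ih hB)
    have h2 := (hMN ((N ^ (k + 1)) *ᵥ g)).trans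
      (mul_le_mul_of_nonneg_left (norm_pow_mulVec_le hB hN g (k + 1)) hη)
    refine (add_le_add h1 h2).trans (le_of_eq ?_)
    push_cast
    ring

/-! ### Moments of a positive semidefinite matrix -/

theorem Matrix.PosSemidef.dotProduct_pow_mulVec_nonneg {M : Matrix V V ℝ} (hM : M.PosSemidef)
    (g : V → ℝ) (k : ℕ) : 0 ≤ g ⬝ᵥ (M ^ k) *ᵥ g :=
  (hM.pow k).dotProduct_mulVec_self_nonneg g

/-- The moments `k ↦ gᵀ M^k g` of a positive semidefinite matrix are log-convex. -/
theorem Matrix.PosSemidef.sq_moment_le {M : Matrix V V ℝ} (hM : M.PosSemidef)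
    (g : V → ℝ) (k : ℕ) :
    (g ⬝ᵥ (M ^ (k + 1)) *ᵥ g) ^ 2 ≤ (g ⬝ᵥ (M ^ k) *ᵥ g) * (g ⬝ᵥ (M ^ (k + 2)) *ᵥ g) := by
  have h1 : g ⬝ᵥ (M ^ (k + 1)) *ᵥ g = g ⬝ᵥ (M ^ k) *ᵥ (M *ᵥ g) := by
    rw [Matrix.mulVec_mulVec, ← pow_succ]
  have h2 : g ⬝ᵥ (M ^ (k + 2)) *ᵥ g = (M *ᵥ g) ⬝ᵥ (M ^ k) *ᵥ (M *ᵥ g) := by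
    rw [dotProduct_comm (M *ᵥ g), hM.dotProduct_mulVec_comm, Matrix.mulVec_mulVec,
      Matrix.mulVec_mulVec, ← pow_succ', ← pow_succ]
  rw [h1, h2]
  exact (hM.pow k).sq_dotProduct_mulVec_le g (M *ᵥ g)

/-- For a nonnegative log-convex sequence `a`, the power means `(a k / a 0) ^ (1 / k)` increase; this
is that fact for consecutive indices, with roots and quotients cleared. -/
theorem pow_succ_le_of_logConvex {a : ℕ → ℝ} (h0 : ∀ k, 0 ≤ a k)
    (h : ∀ k, a (k + 1) ^ 2 ≤ a k * a (k + 2)) (k : ℕ) :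
    a k ^ (k + 1) ≤ a 0 * a (k + 1) ^ k := by
  induction k with
  | zero => simp
  | succ k ih =>
    rcases (h0 (k + 1)).eq_or_lt with h1 | h1
    · rw [← h1, zero_pow (by omega)]
      have := h0 0; have := h0 (k + 1 + 1); positivity
    · have h2 : (a (k + 1) ^ 2) ^ (k + 1) ≤ (a k * a (k + 2)) ^ (k + 1) :=
        pow_le_pow_left₀ (by positivity) (h k) _
      have h3 : (a k * a (k + 2)) ^ (k + 1) ≤ a 0 * a (k + 1) ^ k * a (k + 2) ^ (k + 1) := by
        rw [mul_pow]
        exact mul_le_mul_of_nonneg_right ih (pow_nonneg (h0 _) _)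
      have h4 : a (k + 1) ^ k * a (k + 1) ^ (k + 1 + 1)
          ≤ a (k + 1) ^ k * (a 0 * a (k + 2) ^ (k + 1)) := by
        calc _ = (a (k + 1) ^ 2) ^ (k + 1) := by ring
          _ ≤ _ := h2.trans h3
          _ = _ := by ring
      exact le_of_mul_le_mul_left h4 (by positivity)

/-- The bandwidth estimate of a fixed vector increases with its order, when `M` is positive
semidefinite. -/
theorem Matrix.PosSemidef.rpow_moment_mono {M : Matrix V V ℝ} (hM : M.PosSemidef)
    (g : V → ℝ) {j k : ℕ} (hj : 0 < j) (hjk : j ≤ k) :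
    ((g ⬝ᵥ (M ^ j) *ᵥ g) / (g ⬝ᵥ g)) ^ (1 / (j : ℝ))
      ≤ ((g ⬝ᵥ (M ^ k) *ᵥ g) / (g ⬝ᵥ g)) ^ (1 / (k : ℝ)) := by
  have hgg : 0 ≤ g ⬝ᵥ g := by rw [← norm_toLp_sq]; positivity
  induction k, hjk using Nat.le_induction with
  | base => exact le_rfl
  | succ k hjk ih =>
    refine ih.trans ?_
    have hk : 0 < k := by omega
    set b : ℕ → ℝ := fun k => (g ⬝ᵥ (M ^ k) *ᵥ g) / (g ⬝ᵥ g) with hb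
    have hb0 : ∀ k, 0 ≤ b k := fun k => div_nonneg (hM.dotProduct_pow_mulVec_nonneg g k) hgg
    have hconv : ∀ k, b (k + 1) ^ 2 ≤ b k * b (k + 2) := by
      intro k
      simp only [hb]
      rw [div_pow, div_mul_div_comm, ← pow_two]
      exact div_le_div_of_nonneg_right (hM.sq_moment_le g k) (by positivity)
    have h1 := pow_succ_le_of_logConvex hb0 hconv k
    have hb1 : b 0 ≤ 1 := by
      simp only [hb, pow_zero, Matrix.one_mulVec]
      exact div_self_le_one _
    have h2 : b k ^ (k + 1) ≤ b (k + 1) ^ k :=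
      h1.trans (mul_le_of_le_one_left (pow_nonneg (hb0 _) _) hb1)
    change b k ^ (1 / (k : ℝ)) ≤ b (k + 1) ^ (1 / ((k + 1 : ℕ) : ℝ))
    have h3 : (b k ^ (k + 1)) ^ (1 / ((k : ℝ) * (k + 1 : ℕ)))
        ≤ (b (k + 1) ^ k) ^ (1 / ((k : ℝ) * (k + 1 : ℕ))) :=
      Real.rpow_le_rpow (pow_nonneg (hb0 _) _) h2 (by positivity)
    have hk' : (k : ℝ) ≠ 0 := by positivity
    rw [← Real.rpow_natCast, ← Real.rpow_natCast, ← Real.rpow_mul (hb0 _),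
      ← Real.rpow_mul (hb0 _)] at h3
    have e1 : ((k + 1 : ℕ) : ℝ) * (1 / ((k : ℝ) * (k + 1 : ℕ))) = 1 / (k : ℝ) := by
      have : ((k + 1 : ℕ) : ℝ) ≠ 0 := by positivity
      field_simp
    have e2 : (k : ℝ) * (1 / ((k : ℝ) * (k + 1 : ℕ))) = 1 / ((k + 1 : ℕ) : ℝ) := by
      have : ((k + 1 : ℕ) : ℝ) ≠ 0 := by positivity
      field_simp
    rwa [e1, e2] at h3

/-! ### Laplacians of weighted graphs -/

/-- The Laplacian `c (D - W)` of the weights `w`, where `D` is the diagonal matrix of row sums. -/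
def scaledLaplacian (c : ℝ) (w : Matrix V V ℝ) : Matrix V V ℝ :=
  c • (Matrix.diagonal (fun i => ∑ j, w i j) - w)

theorem scaledLaplacian_mulVec_apply (c : ℝ) (w : Matrix V V ℝ) (v : V → ℝ) (i : V) :
    (scaledLaplacian c w *ᵥ v) i = c * ∑ j, w i j * (v i - v j) := by
  rw [scaledLaplacian, Matrix.smul_mulVec, Matrix.sub_mulVec, Pi.smul_apply, Pi.sub_apply,
    smul_eq_mul, Matrix.mulVec_diagonal]
  simp only [Matrix.mulVec, dotProduct, mul_sub, Finset.sum_sub_distrib, Finset.sum_mul]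

theorem dotProduct_scaledLaplacian (c : ℝ) (w : Matrix V V ℝ) (v : V → ℝ) :
    v ⬝ᵥ scaledLaplacian c w *ᵥ v
      = c * ∑ i, (∑ j, w i j) * v i ^ 2 - c * ∑ i, ∑ j, v i * v j * w i j := by
  simp only [dotProduct, scaledLaplacian_mulVec_apply]
  rw [← mul_sub, ← Finset.sum_sub_distrib, Finset.mul_sum]
  refine Finset.sum_congr rfl fun i _ => ?_
  rw [Finset.sum_mul, ← Finset.sum_sub_distrib, mul_left_comm, Finset.mul_sum]
  congr 1
  exact Finset.sum_congr rfl fun j _ => by ring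

theorem dotProduct_scaledLaplacian_eq (c : ℝ) {w : Matrix V V ℝ} (hw : ∀ i j, w i j = w j i)
    (v : V → ℝ) :
    v ⬝ᵥ scaledLaplacian c w *ᵥ v = c / 2 * ∑ i, ∑ j, w i j * (v i - v j) ^ 2 := by
  have h1 : ∑ i, ∑ j, w i j * v j ^ 2 = ∑ i, (∑ j, w i j) * v i ^ 2 := by
    rw [Finset.sum_comm]
    refine Finset.sum_congr rfl fun i _ => ?_
    rw [Finset.sum_mul]
    exact Finset.sum_congr rfl fun j _ => by rw [hw]
  have h2 : ∑ i, ∑ j, w i j * (v i - v j) ^ 2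
      = ∑ i, (∑ j, w i j) * v i ^ 2 + ∑ i, ∑ j, w i j * v j ^ 2
        - 2 * ∑ i, ∑ j, v i * v j * w i j := by
    simp only [Finset.sum_mul, Finset.mul_sum, ← Finset.sum_add_distrib, ← Finset.sum_sub_distrib]
    exact Finset.sum_congr rfl fun i _ => Finset.sum_congr rfl fun j _ => by ring
  rw [dotProduct_scaledLaplacian, h2, h1]
  ring

theorem posSemidef_scaledLaplacian {c : ℝ} (hc : 0 ≤ c) {w : Matrix V V ℝ}
    (hw : ∀ i j, w i j = w j i) (h0 : ∀ i j, 0 ≤ w i j) : (scaledLaplacian c w).PosSemidef := by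
  refine .of_dotProduct_mulVec_nonneg ?_ fun v => ?_
  · ext i j
    simp only [scaledLaplacian, Matrix.conjTranspose_apply, star_trivial, Matrix.smul_apply,
      Matrix.sub_apply, Matrix.diagonal_apply, hw j i]
    by_cases h : i = j
    · subst h; rfl
    · simp [h, Ne.symm h]
  · rw [star_trivial, dotProduct_scaledLaplacian_eq c hw]
    have : 0 ≤ ∑ i, ∑ j, w i j * (v i - v j) ^ 2 :=
      Finset.sum_nonneg fun i _ => Finset.sum_nonneg fun j _ => mul_nonneg (h0 i j) (sq_nonneg _)
    positivity

theorem dotProduct_scaledLaplacian_mono {c : ℝ} (hc : 0 ≤ c) {w w' : Matrix V V ℝ}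
    (hw : ∀ i j, w i j = w j i) (hw' : ∀ i j, w' i j = w' j i) (h : ∀ i j, w i j ≤ w' i j)
    (v : V → ℝ) :
    v ⬝ᵥ scaledLaplacian c w *ᵥ v ≤ v ⬝ᵥ scaledLaplacian c w' *ᵥ v := by
  rw [dotProduct_scaledLaplacian_eq c hw, dotProduct_scaledLaplacian_eq c hw']
  gcongr with i _ j _
  exact h i j

theorem norm_scaledLaplacian_mulVec_le {κ : ℝ} {w : Matrix V V ℝ}
    (hw : ∀ i j, w i j = w j i) (h0 : ∀ i j, 0 ≤ w i j) (hκ : ∀ i j, w i j ≤ κ) (hκ0 : 0 ≤ κ)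
    (v : V → ℝ) :
    ‖WithLp.toLp 2 (scaledLaplacian (1 / (Fintype.card V : ℝ)) w *ᵥ v)‖
      ≤ 2 * κ * ‖WithLp.toLp 2 v‖ := by
  refine (posSemidef_scaledLaplacian (by positivity) hw h0).norm_mulVec_le_of_forall
    (by positivity) (fun v => ?_) v
  rw [dotProduct_scaledLaplacian_eq _ hw]
  have h1 : ∑ i, ∑ j, w i j * (v i - v j) ^ 2 ≤ ∑ i : V, ∑ j : V, κ * (2 * (v i ^ 2 + v j ^ 2)) := by
    gcongr with i _ j _
    · exact hκ i j
    · nlinarith [sq_nonneg (v i + v j)]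
  have h2 : ∑ i : V, ∑ j : V, κ * (2 * (v i ^ 2 + v j ^ 2))
      = Fintype.card V * (4 * κ * (v ⬝ᵥ v)) := by
    simp only [← Finset.mul_sum, Finset.sum_add_distrib, Finset.sum_const, Finset.card_univ,
      nsmul_eq_mul, dotProduct, ← pow_two]
    ring
  calc _ ≤ 1 / (Fintype.card V : ℝ) / 2 * (Fintype.card V * (4 * κ * (v ⬝ᵥ v))) := by
        rw [← h2]; gcongr
    _ ≤ 2 * κ * (v ⬝ᵥ v) := by
        have h3 : (1 / (Fintype.card V : ℝ)) * Fintype.card V ≤ 1 := by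
          rw [one_div, mul_comm]; exact mul_inv_le_one
        have h4 : 0 ≤ v ⬝ᵥ v := by rw [← norm_toLp_sq]; positivity
        have h5 : 0 ≤ κ * (v ⬝ᵥ v) := mul_nonneg hκ0 h4
        nlinarith

end LinearAlgebra

/-! ### The Gaussian kernel -/

section GaussianKernel

variable {d : ℕ}

/-- The value `(2πσ²)^{-d/2}` of the Gaussian kernel on the diagonal, which is its maximum. -/
noncomputable def gaussianPeak (d : ℕ) (σ : ℝ) : ℝ := 1 / (2 * Real.pi * σ ^ 2) ^ ((d : ℝ) / 2)

theorem gaussianPeak_nonneg (d : ℕ) (σ : ℝ) : 0 ≤ gaussianPeak d σ := by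
  unfold gaussianPeak; positivity

theorem gaussianPeak_pos (d : ℕ) {σ : ℝ} (hσ : 0 < σ) : 0 < gaussianPeak d σ := by
  unfold gaussianPeak; positivity

theorem gaussianKernel_eq (σ : ℝ) (x y : EuclideanSpace ℝ (Fin d)) :
    gaussianKernel σ x y = gaussianPeak d σ * Real.exp (-‖x - y‖ ^ 2 / (2 * σ ^ 2)) := rfl

theorem gaussianKernel_nonneg (σ : ℝ) (x y : EuclideanSpace ℝ (Fin d)) :
    0 ≤ gaussianKernel σ x y := by
  rw [gaussianKernel_eq]; exact mul_nonneg (gaussianPeak_nonneg d σ) (Real.exp_nonneg _)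

theorem gaussianKernel_comm (σ : ℝ) (x y : EuclideanSpace ℝ (Fin d)) :
    gaussianKernel σ x y = gaussianKernel σ y x := by
  rw [gaussianKernel_eq, gaussianKernel_eq, norm_sub_rev]

theorem gaussianKernel_self (σ : ℝ) (x : EuclideanSpace ℝ (Fin d)) :
    gaussianKernel σ x x = gaussianPeak d σ := by simp [gaussianKernel_eq]

theorem gaussianKernel_le_of_le_norm {σ r : ℝ} (hr : 0 ≤ r) {x y : EuclideanSpace ℝ (Fin d)}
    (h : r ≤ ‖x - y‖) :
    gaussianKernel σ x y ≤ gaussianPeak d σ * Real.exp (-r ^ 2 / (2 * σ ^ 2)) := by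
  rw [gaussianKernel_eq]
  have := gaussianPeak_nonneg d σ
  gcongr

theorem gaussianKernel_le (σ : ℝ) (x y : EuclideanSpace ℝ (Fin d)) :
    gaussianKernel σ x y ≤ gaussianPeak d σ := by
  simpa using gaussianKernel_le_of_le_norm (σ := σ) le_rfl (norm_nonneg (x - y))

theorem continuous_gaussianKernel (σ : ℝ) :
    Continuous fun z : EuclideanSpace ℝ (Fin d) × EuclideanSpace ℝ (Fin d) =>
      gaussianKernel σ z.1 z.2 := by
  simp only [gaussianKernel_eq]
  fun_prop

theorem integral_exp_neg_mul_norm_sub_sq {b : ℝ} (hb : 0 < b) (x : EuclideanSpace ℝ (Fin d)) :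
    ∫ y, Real.exp (-b * ‖x - y‖ ^ 2) = (Real.pi / b) ^ ((d : ℝ) / 2) := by
  rw [integral_sub_left_eq_self (fun y : EuclideanSpace ℝ (Fin d) => Real.exp (-b * ‖y‖ ^ 2)),
    GaussianFourier.integral_rexp_neg_mul_sq_norm hb, finrank_euclideanSpace_fin]

theorem integrable_exp_neg_mul_norm_sub_sq {b : ℝ} (hb : 0 < b) (x : EuclideanSpace ℝ (Fin d)) :
    Integrable fun y => Real.exp (-b * ‖x - y‖ ^ 2) := by
  refine not_imp_comm.1 integral_undef ?_
  rw [integral_exp_neg_mul_norm_sub_sq hb]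
  positivity

theorem integral_gaussianKernel {σ : ℝ} (hσ : 0 < σ) (x : EuclideanSpace ℝ (Fin d)) :
    ∫ y, gaussianKernel σ x y = 1 := by
  have h : ∀ y, gaussianKernel σ x y
      = gaussianPeak d σ * Real.exp (-(1 / (2 * σ ^ 2)) * ‖x - y‖ ^ 2) := by
    intro y
    rw [gaussianKernel_eq]
    ring_nf
  simp only [h]
  rw [integral_const_mul, integral_exp_neg_mul_norm_sub_sq (by positivity), gaussianPeak,
    show Real.pi / (1 / (2 * σ ^ 2)) = 2 * Real.pi * σ ^ 2 by field_simp]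
  exact one_div_mul_cancel (by positivity)

theorem integrable_gaussianKernel {σ : ℝ} (hσ : 0 < σ) (x : EuclideanSpace ℝ (Fin d)) :
    Integrable fun y => gaussianKernel σ x y := by
  refine not_imp_comm.1 integral_undef ?_
  rw [integral_gaussianKernel hσ]
  exact one_ne_zero

/-- From `u e^{-u²/2} ≤ e^{-u²/4}` with `u = ‖x - y‖ / σ`: the first moment of the kernel is
controlled by the total mass of a wider kernel. -/
theorem gaussianKernel_mul_norm_le {σ : ℝ} (hσ : 0 < σ) (x y : EuclideanSpace ℝ (Fin d)) :
    gaussianKernel σ x y * ‖x - y‖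
      ≤ σ * 2 ^ ((d : ℝ) / 2) * gaussianKernel (√2 * σ) x y := by
  have hpeak : 2 ^ ((d : ℝ) / 2) * gaussianPeak d (√2 * σ) = gaussianPeak d σ := by
    rw [gaussianPeak, gaussianPeak, mul_pow, Real.sq_sqrt zero_le_two,
      show 2 * Real.pi * (2 * σ ^ 2) = 2 * (2 * Real.pi * σ ^ 2) by ring,
      Real.mul_rpow zero_le_two (by positivity)]
    field_simp
  rw [gaussianKernel_eq, gaussianKernel_eq]
  set t := ‖x - y‖
  have ht : 0 ≤ t := norm_nonneg _
  have h1 : t / σ ≤ Real.exp ((t / σ) ^ 2 / 4) := by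
    have := Real.add_one_le_exp ((t / σ) ^ 2 / 4)
    nlinarith [sq_nonneg (t / σ - 2)]
  have h2 : t ≤ σ * Real.exp ((t / σ) ^ 2 / 4) := by
    rw [div_le_iff₀ hσ] at h1; linarith
  have h3 : Real.exp (-t ^ 2 / (2 * σ ^ 2)) * Real.exp ((t / σ) ^ 2 / 4)
      = Real.exp (-t ^ 2 / (2 * (√2 * σ) ^ 2)) := by
    rw [← Real.exp_add, mul_pow, Real.sq_sqrt zero_le_two]
    congr 1
    field_simp
    ring
  have := gaussianPeak_nonneg d σ
  calc gaussianPeak d σ * Real.exp (-t ^ 2 / (2 * σ ^ 2)) * t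
      ≤ gaussianPeak d σ * Real.exp (-t ^ 2 / (2 * σ ^ 2)) * (σ * Real.exp ((t / σ) ^ 2 / 4)) := by
        gcongr
    _ = σ * gaussianPeak d σ
          * (Real.exp (-t ^ 2 / (2 * σ ^ 2)) * Real.exp ((t / σ) ^ 2 / 4)) := by ring
    _ = _ := by rw [h3, ← hpeak]; ring

/-- Smoothing a Lipschitz function with the Gaussian kernel moves it by `O(σ)`. -/
theorem abs_integral_gaussianKernel_mul_sub_le {σ : ℝ} (hσ : 0 < σ)
    {q : EuclideanSpace ℝ (Fin d) → ℝ} {K : NNReal} (hq : LipschitzWith K q)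
    (hint : Integrable q) (x : EuclideanSpace ℝ (Fin d)) :
    |(∫ y, gaussianKernel σ x y * q y) - q x| ≤ K * (σ * 2 ^ ((d : ℝ) / 2)) := by
  have hσ2 : 0 < √2 * σ := by positivity
  have hI : Integrable fun y => gaussianKernel σ x y * q y := by
    refine hint.bdd_mul (c := gaussianPeak d σ) ?_ ?_
    · exact ((continuous_gaussianKernel σ).comp (by fun_prop :
        Continuous fun y => (x, y))).aestronglyMeasurable
    · refine ae_of_all _ fun y => ?_
      rw [Real.norm_of_nonneg (gaussianKernel_nonneg _ _ _)]
      exact gaussianKernel_le _ _ _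
  have h1 : (∫ y, gaussianKernel σ x y * q y) - q x
      = ∫ y, gaussianKernel σ x y * (q y - q x) := by
    simp only [mul_sub]
    rw [integral_sub hI ((integrable_gaussianKernel hσ x).mul_const _), integral_mul_const,
      integral_gaussianKernel hσ, one_mul]
  rw [h1, ← Real.norm_eq_abs]
  calc ‖∫ y, gaussianKernel σ x y * (q y - q x)‖
      ≤ ∫ y, K * (σ * 2 ^ ((d : ℝ) / 2)) * gaussianKernel (√2 * σ) x y := by
        refine norm_integral_le_of_norm_le ((integrable_gaussianKernel hσ2 x).const_mul _)
          (ae_of_all _ fun y => ?_)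
        rw [norm_mul, Real.norm_of_nonneg (gaussianKernel_nonneg _ _ _)]
        have h2 : ‖q y - q x‖ ≤ K * ‖x - y‖ := by
          rw [norm_sub_rev x y]; exact hq.norm_sub_le y x
        calc _ ≤ gaussianKernel σ x y * (K * ‖x - y‖) :=
              mul_le_mul_of_nonneg_left h2 (gaussianKernel_nonneg _ _ _)
          _ = K * (gaussianKernel σ x y * ‖x - y‖) := by ring
          _ ≤ K * (σ * 2 ^ ((d : ℝ) / 2) * gaussianKernel (√2 * σ) x y) :=
              mul_le_mul_of_nonneg_left (gaussianKernel_mul_norm_le hσ x y) K.coe_nonneg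
          _ = _ := by ring
    _ = K * (σ * 2 ^ ((d : ℝ) / 2)) := by
        rw [integral_const_mul, integral_gaussianKernel hσ2, mul_one]

/-- The Gaussian kernel is positive definite: by the parallelogram law it is a positive multiple of
`∫ φ(x - z) φ(y - z) dz` for a Gaussian `φ`. -/
theorem sum_mul_gaussianKernel_nonneg {σ : ℝ} (hσ : 0 < σ) {V : Type*} [Fintype V]
    (x : V → EuclideanSpace ℝ (Fin d)) (v : V → ℝ) :
    0 ≤ ∑ i, ∑ j, v i * v j * gaussianKernel σ (x i) (x j) := by
  set b : ℝ := 1 / σ ^ 2 with hb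
  have hb0 : 0 < b := by positivity
  set φ : EuclideanSpace ℝ (Fin d) → EuclideanSpace ℝ (Fin d) → ℝ :=
    fun y z => Real.exp (-b * ‖y - z‖ ^ 2)
  have hmul : ∀ y y' z, φ y z * φ y' z
      = Real.exp (-‖y - y'‖ ^ 2 / (2 * σ ^ 2))
        * Real.exp (-(2 * b) * ‖(1 / 2 : ℝ) • (y + y') - z‖ ^ 2) := by
    intro y y' z
    have h := parallelogram_law_with_norm ℝ (y - z) (y' - z)
    have h1 : y - z + (y' - z) = (2 : ℝ) • ((1 / 2 : ℝ) • (y + y') - z) := by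
      module
    have h2 : y - z - (y' - z) = y - y' := by abel
    rw [h1, h2, norm_smul, Real.norm_of_nonneg zero_le_two] at h
    simp only [φ]
    rw [← Real.exp_add, ← Real.exp_add]
    congr 1
    have h3 : ‖y - z‖ ^ 2 + ‖y' - z‖ ^ 2
        = 2 * ‖(1 / 2 : ℝ) • (y + y') - z‖ ^ 2 + ‖y - y'‖ ^ 2 / 2 := by linarith
    calc -b * ‖y - z‖ ^ 2 + -b * ‖y' - z‖ ^ 2 = -b * (‖y - z‖ ^ 2 + ‖y' - z‖ ^ 2) := by ring
      _ = _ := by rw [h3, hb]; field_simp; ring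
  have hint : ∀ y y', Integrable fun z => φ y z * φ y' z := by
    intro y y'
    simp only [hmul]
    exact (integrable_exp_neg_mul_norm_sub_sq (by positivity) _).const_mul _
  set c : ℝ := (Real.pi / (2 * b)) ^ ((d : ℝ) / 2) with hc
  have hc0 : 0 < c := by positivity
  have hval : ∀ y y', ∫ z, φ y z * φ y' z = Real.exp (-‖y - y'‖ ^ 2 / (2 * σ ^ 2)) * c := by
    intro y y'
    simp only [hmul]
    rw [integral_const_mul, integral_exp_neg_mul_norm_sub_sq (by positivity)]
  have hpos : 0 ≤ ∫ z, (∑ i, v i * φ (x i) z) ^ 2 := integral_nonneg fun z => sq_nonneg _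
  have hexp : ∫ z, (∑ i, v i * φ (x i) z) ^ 2
      = ∑ i, ∑ j, v i * v j * (Real.exp (-‖x i - x j‖ ^ 2 / (2 * σ ^ 2)) * c) := by
    have : ∀ z, (∑ i, v i * φ (x i) z) ^ 2
        = ∑ i, ∑ j, v i * v j * (φ (x i) z * φ (x j) z) := by
      intro z
      rw [pow_two, Finset.sum_mul_sum]
      exact Finset.sum_congr rfl fun i _ => Finset.sum_congr rfl fun j _ => by ring
    simp only [this]
    rw [integral_finsetSum _ fun i _ => integrable_finsetSum _ fun j _ =>
      (hint (x i) (x j)).const_mul _]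
    refine Finset.sum_congr rfl fun i _ => ?_
    rw [integral_finsetSum _ fun j _ => (hint (x i) (x j)).const_mul _]
    exact Finset.sum_congr rfl fun j _ => by rw [integral_const_mul, hval]
  have hfin : ∑ i, ∑ j, v i * v j * gaussianKernel σ (x i) (x j)
      = gaussianPeak d σ / c * ∫ z, (∑ i, v i * φ (x i) z) ^ 2 := by
    rw [hexp, Finset.mul_sum]
    refine Finset.sum_congr rfl fun i _ => ?_
    rw [Finset.mul_sum]
    refine Finset.sum_congr rfl fun j _ => ?_
    rw [gaussianKernel_eq]
    field_simp
  rw [hfin]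
  exact mul_nonneg (div_nonneg (gaussianPeak_nonneg d σ) hc0.le) hpos

end GaussianKernel

section GraphLaplacian

variable {d n : ℕ}

theorem graphLaplacian_eq_scaledLaplacian (σ : ℝ) (x : Fin n → EuclideanSpace ℝ (Fin d)) :
    graphLaplacian σ x = scaledLaplacian (1 / (Fintype.card (Fin n) : ℝ)) (weightMatrix σ x) := by
  simp [graphLaplacian, scaledLaplacian, degreeMatrix]

theorem weightMatrix_apply (σ : ℝ) (x : Fin n → EuclideanSpace ℝ (Fin d)) (i j : Fin n) :
    weightMatrix σ x i j = if i = j then 0 else gaussianKernel σ (x i) (x j) := rfl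

theorem weightMatrix_comm (σ : ℝ) (x : Fin n → EuclideanSpace ℝ (Fin d)) (i j : Fin n) :
    weightMatrix σ x i j = weightMatrix σ x j i := by
  simp only [weightMatrix_apply, eq_comm (a := i), gaussianKernel_comm σ (x i)]

theorem weightMatrix_nonneg (σ : ℝ) (x : Fin n → EuclideanSpace ℝ (Fin d)) (i j : Fin n) :
    0 ≤ weightMatrix σ x i j := by
  rw [weightMatrix_apply]; split_ifs
  exacts [le_rfl, gaussianKernel_nonneg _ _ _]

theorem weightMatrix_le (σ : ℝ) (x : Fin n → EuclideanSpace ℝ (Fin d)) (i j : Fin n) :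
    weightMatrix σ x i j ≤ gaussianPeak d σ := by
  rw [weightMatrix_apply]; split_ifs
  exacts [gaussianPeak_nonneg _ _, gaussianKernel_le _ _ _]

theorem posSemidef_graphLaplacian (σ : ℝ) (x : Fin n → EuclideanSpace ℝ (Fin d)) :
    (graphLaplacian σ x).PosSemidef := by
  rw [graphLaplacian_eq_scaledLaplacian]
  exact posSemidef_scaledLaplacian (by positivity) (weightMatrix_comm σ x) (weightMatrix_nonneg σ x)

/-- Since the Gaussian kernel is positive definite, `-W` is at most its diagonal defect
`(2πσ²)^{-d/2} I`. So the Laplacian is bounded by the degrees, without the factor `2` that holds for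
general weights. -/
theorem dotProduct_graphLaplacian_le {σ : ℝ} (hσ : 0 < σ) (x : Fin n → EuclideanSpace ℝ (Fin d))
    {v : Fin n → ℝ} {θ : ℝ}
    (h : ∀ i, v i ≠ 0 → 1 / (n : ℝ) * ∑ j, weightMatrix σ x i j ≤ θ) :
    v ⬝ᵥ graphLaplacian σ x *ᵥ v ≤ (θ + gaussianPeak d σ / n) * (v ⬝ᵥ v) := by
  rw [graphLaplacian_eq_scaledLaplacian, dotProduct_scaledLaplacian, Fintype.card_fin]
  have h1 : 1 / (n : ℝ) * ∑ i, (∑ j, weightMatrix σ x i j) * v i ^ 2 ≤ θ * (v ⬝ᵥ v) := by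
    simp only [dotProduct, Finset.mul_sum]
    refine Finset.sum_le_sum fun i _ => ?_
    by_cases hi : v i = 0
    · simp [hi]
    · have := mul_le_mul_of_nonneg_right (h i hi) (sq_nonneg (v i))
      simp only [Finset.mul_sum] at this
      rw [← mul_assoc, Finset.mul_sum, ← pow_two]
      exact this
  have h2 : ∑ i, ∑ j, v i * v j * gaussianKernel σ (x i) (x j)
      = ∑ i, ∑ j, v i * v j * weightMatrix σ x i j + gaussianPeak d σ * (v ⬝ᵥ v) := by
    simp only [dotProduct, Finset.mul_sum, ← Finset.sum_add_distrib]
    refine Finset.sum_congr rfl fun i _ => ?_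
    have : ∀ j, v i * v j * gaussianKernel σ (x i) (x j) = v i * v j * weightMatrix σ x i j
        + if i = j then gaussianPeak d σ * (v i * v i) else 0 := by
      intro j
      rw [weightMatrix_apply]
      split_ifs with hij
      · subst hij; rw [gaussianKernel_self]; ring
      · ring
    simp only [this, Finset.sum_add_distrib, Finset.sum_ite_eq, Finset.mem_univ, if_true]
  have h3 := sum_mul_gaussianKernel_nonneg hσ x v
  rw [h2] at h3
  have h4 : 1 / (n : ℝ) * (-(gaussianPeak d σ * (v ⬝ᵥ v)))
      ≤ 1 / (n : ℝ) * ∑ i, ∑ j, v i * v j * weightMatrix σ x i j :=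
    mul_le_mul_of_nonneg_left (by linarith) (by positivity)
  calc _ ≤ θ * (v ⬝ᵥ v) - 1 / (n : ℝ) * (-(gaussianPeak d σ * (v ⬝ᵥ v))) := by linarith
    _ = _ := by ring

end GraphLaplacian

/-! ### Concentration of empirical averages -/

section Concentration

variable {Ω S V : Type*} [MeasurableSpace Ω] [MeasurableSpace S] {μ : Measure Ω}
  [IsProbabilityMeasure μ] {ν : Measure S} {Z : V → Ω → S}

/-- Hoeffding's inequality, two-sided, for a bounded function of independent copies. -/
theorem measureReal_le_abs_sum_sub_integral_le (hind : iIndepFun Z μ)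
    (hlaw : ∀ i, HasLaw (Z i) ν μ) {h : S → ℝ} (hh : Measurable h) {b : ℝ} (hb : ∀ z, |h z| ≤ b)
    (s : Finset V) {ε : ℝ} (hε : 0 ≤ ε) :
    μ.real {ω | ε ≤ |∑ j ∈ s, (h (Z j ω) - ∫ z, h z ∂ν)|}
      ≤ 2 * Real.exp (-ε ^ 2 / (2 * (s.card * b ^ 2))) := by
  have key : ∀ g : S → ℝ, Measurable g → (∀ z, |g z| ≤ b) →
      μ.real {ω | ε ≤ ∑ j ∈ s, (g (Z j ω) - ∫ z, g z ∂ν)}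
        ≤ Real.exp (-ε ^ 2 / (2 * (s.card * b ^ 2))) := by
    intro g hg hgb
    have hsub : ∀ j ∈ s, HasSubgaussianMGF (fun ω => g (Z j ω) - ∫ z, g z ∂ν)
        ((‖b - -b‖₊ / 2) ^ 2) μ := by
      intro j _
      have h1 := hasSubgaussianMGF_of_mem_Icc (μ := μ) (X := fun ω => g (Z j ω)) (a := -b) (b := b)
        (hg.comp_aemeasurable (hlaw j).aemeasurable) (ae_of_all _ fun ω => abs_le.1 (hgb _))
      have h2 : ∫ ω, g (Z j ω) ∂μ = ∫ z, g z ∂ν := by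
        rw [← (hlaw j).map_eq, integral_map (hlaw j).aemeasurable hg.aestronglyMeasurable]
      rwa [h2] at h1
    have hi : iIndepFun (fun j ω => g (Z j ω) - ∫ z, g z ∂ν) μ :=
      hind.comp (fun _ z => g z - ∫ z, g z ∂ν) fun _ => hg.sub_const _
    refine (HasSubgaussianMGF.measure_sum_ge_le_of_iIndepFun hi hsub hε).trans (le_of_eq ?_)
    congr 3
    have h3 : (((‖b - -b‖₊ / 2) ^ 2 : NNReal) : ℝ) = b ^ 2 := by
      push_cast
      rw [Real.norm_eq_abs, div_pow, sq_abs]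
      ring
    rw [NNReal.coe_sum, Finset.sum_const, nsmul_eq_mul, h3]
  have h1 := key h hh hb
  have h2 := key (fun z => -h z) hh.neg (fun z => by rw [abs_neg]; exact hb z)
  have hsub : {ω | ε ≤ |∑ j ∈ s, (h (Z j ω) - ∫ z, h z ∂ν)|}
      ⊆ {ω | ε ≤ ∑ j ∈ s, (h (Z j ω) - ∫ z, h z ∂ν)}
        ∪ {ω | ε ≤ ∑ j ∈ s, (-h (Z j ω) - ∫ z, -h z ∂ν)} := by
    intro ω hω
    have hneg : ∑ j ∈ s, (-h (Z j ω) - ∫ z, -h z ∂ν)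
        = -∑ j ∈ s, (h (Z j ω) - ∫ z, h z ∂ν) := by
      rw [integral_neg, ← Finset.sum_neg_distrib]
      exact Finset.sum_congr rfl fun j _ => by ring
    simp only [Set.mem_union, Set.mem_ofPred_eq, hneg] at hω ⊢
    exact le_abs.1 hω
  calc _ ≤ _ := measureReal_mono hsub
    _ ≤ _ := measureReal_union_le _ _
    _ ≤ _ := by linarith

variable [Fintype V]

/-- Hoeffding's inequality conditionally on one of the points: the summands are functions of that
point and of the remaining ones. -/
theorem measureReal_le_abs_sum_erase_sub_integral_le [SFinite ν] [DecidableEq V] (hind : iIndepFun Z μ)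
    (hlaw : ∀ i, HasLaw (Z i) ν μ) {F : S → S → ℝ} (hF : Measurable (Function.uncurry F)) {b : ℝ}
    (hb : ∀ z z', |F z z'| ≤ b) (i : V) {ε : ℝ} (hε : 0 ≤ ε) :
    μ.real {ω | ε ≤ |∑ j ∈ Finset.univ.erase i, (F (Z i ω) (Z j ω) - ∫ z, F (Z i ω) z ∂ν)|}
      ≤ 2 * Real.exp (-ε ^ 2 / (2 * ((Finset.univ.erase i).card * b ^ 2))) := by
  set T : Finset V := Finset.univ.erase i with hT
  set rest : Ω → (T → S) := fun ω j => Z j ω with hrest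
  have hrestm : AEMeasurable rest μ := aemeasurable_pi_lambda _ fun j => (hlaw j).aemeasurable
  have hi : IndepFun (Z i) rest μ := by
    have h := hind.indepFun_finset₀ {i} T (by simp [hT]) fun j => (hlaw j).aemeasurable
    exact h.comp (measurable_pi_apply (⟨i, Finset.mem_singleton_self i⟩ : ({i} : Finset V)))
      measurable_id
  have hmap := hi.map_prod_eq_prod_map_map (hlaw i).aemeasurable hrestm
  set G : S → ℝ := fun z => ∫ z', F z z' ∂ν
  have hG : Measurable G := hF.stronglyMeasurable.integral_prod_right.measurable
  set E : Set (S × (T → S)) := {q | ε ≤ |∑ j : T, (F q.1 (q.2 j) - G q.1)|} with hE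
  have hEm : MeasurableSet E := by
    refine measurableSet_le measurable_const (Measurable.abs ?_)
    refine Finset.measurable_sum _ fun j _ => Measurable.sub ?_ (hG.comp measurable_fst)
    exact hF.comp (measurable_fst.prodMk ((measurable_pi_apply j).comp measurable_snd))
  have hset : {ω | ε ≤ |∑ j ∈ T, (F (Z i ω) (Z j ω) - ∫ z, F (Z i ω) z ∂ν)|}
      = (fun ω => (Z i ω, rest ω)) ⁻¹' E := by
    ext ω
    simp only [hE, Set.mem_ofPred_eq, Set.mem_preimage, hrest]
    rw [← Finset.sum_coe_sort T]
  set β : ℝ := 2 * Real.exp (-ε ^ 2 / (2 * (T.card * b ^ 2))) with hβ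
  have hβ0 : 0 ≤ β := by positivity
  have hsec : ∀ z, μ.map rest (Prod.mk z ⁻¹' E) ≤ ENNReal.ofReal β := by
    intro z
    rw [Measure.map_apply_of_aemeasurable hrestm (measurable_prodMk_left hEm),
      ← ofReal_measureReal]
    refine ENNReal.ofReal_le_ofReal ?_
    have h := measureReal_le_abs_sum_sub_integral_le hind hlaw (h := F z)
      (hF.comp measurable_prodMk_left) (hb z) T hε
    refine le_trans (le_of_eq ?_) h
    congr 1
    ext ω
    simp only [hE, Set.mem_ofPred_eq, Set.mem_preimage, hrest]
    rw [← Finset.sum_coe_sort T]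
  have hfin : μ ((fun ω => (Z i ω, rest ω)) ⁻¹' E) ≤ ENNReal.ofReal β := by
    rw [← Measure.map_apply_of_aemeasurable ((hlaw i).aemeasurable.prodMk hrestm) hEm, hmap,
      Measure.prod_apply hEm]
    calc _ ≤ ∫⁻ _, ENNReal.ofReal β ∂(μ.map (Z i)) := lintegral_mono hsec
      _ = ENNReal.ofReal β := by
        have : IsProbabilityMeasure (μ.map (Z i)) :=
          Measure.isProbabilityMeasure_map (hlaw i).aemeasurable
        simp
  rw [hset, measureReal_def]
  exact ENNReal.toReal_le_of_le_ofReal hβ0 hfin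

/-- Averages over the other points, uniformly in the base point. -/
theorem measure_exists_le_abs_average_erase_sub_le [SFinite ν] [DecidableEq V] (hind : iIndepFun Z μ)
    (hlaw : ∀ i, HasLaw (Z i) ν μ) {F : S → S → ℝ} (hF : Measurable (Function.uncurry F)) {b : ℝ}
    (hb : ∀ z z', |F z z'| ≤ b) (hb0 : 0 < b) {ε : ℝ} (hε : 0 ≤ ε) :
    μ {ω | ∃ i, ε * Fintype.card V
        ≤ |∑ j ∈ Finset.univ.erase i, (F (Z i ω) (Z j ω) - ∫ z, F (Z i ω) z ∂ν)|}
      ≤ ENNReal.ofReal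
        (Fintype.card V * (2 * Real.exp (-(ε ^ 2 * Fintype.card V) / (2 * b ^ 2)))) := by
  rw [Set.ofPred_exists]
  refine (measure_iUnion_fintype_le _ _).trans ?_
  have h1 : ∀ i, μ {ω | ε * Fintype.card V
        ≤ |∑ j ∈ Finset.univ.erase i, (F (Z i ω) (Z j ω) - ∫ z, F (Z i ω) z ∂ν)|}
      ≤ ENNReal.ofReal (2 * Real.exp (-(ε ^ 2 * Fintype.card V) / (2 * b ^ 2))) := by
    intro i
    have hN : 0 < (Fintype.card V : ℝ) := by
      have : 0 < Fintype.card V := Fintype.card_pos_iff.2 ⟨i⟩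
      exact_mod_cast this
    rw [← ofReal_measureReal]
    refine ENNReal.ofReal_le_ofReal ?_
    -- With a single point the sum is empty and the exponent of the conditional inequality divides
    -- by zero, so this case is treated apart.
    rcases (Finset.univ.erase i).card.eq_zero_or_pos with h0 | h0
    · rw [Finset.card_eq_zero] at h0
      rcases hε.eq_or_lt with he | he
      · refine measureReal_le_one.trans ?_
        simp [← he]
      · have : {ω | ε * (Fintype.card V : ℝ) ≤ |∑ j ∈ Finset.univ.erase i,
            (F (Z i ω) (Z j ω) - ∫ z, F (Z i ω) z ∂ν)|} = ∅ := by
          ext ω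
          simp only [h0, Finset.sum_empty, abs_zero, Set.mem_ofPred_eq, Set.mem_empty_iff_false,
            iff_false, not_le]
          positivity
        rw [this]
        simp only [measureReal_empty]
        positivity
    refine (measureReal_le_abs_sum_erase_sub_integral_le hind hlaw hF hb i
      (by positivity)).trans ?_
    have hc : ((Finset.univ.erase i).card : ℝ) ≤ Fintype.card V := by
      exact_mod_cast Finset.card_le_univ _
    have hc0 : (0 : ℝ) < (Finset.univ.erase i).card := by exact_mod_cast h0
    gcongr 2 * Real.exp ?_
    rw [neg_div, neg_div]
    refine neg_le_neg ?_
    calc ε ^ 2 * (Fintype.card V : ℝ) / (2 * b ^ 2)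
        = (ε * Fintype.card V) ^ 2 / (2 * (Fintype.card V * b ^ 2)) := by
          field_simp
      _ ≤ _ := by gcongr
  refine (Finset.sum_le_sum fun i _ => h1 i).trans (le_of_eq ?_)
  rw [Finset.sum_const, Finset.card_univ, nsmul_eq_mul, ENNReal.ofReal_mul (Nat.cast_nonneg _),
    ENNReal.ofReal_natCast]

/-- Averages of a fixed bounded function. -/
theorem measure_le_abs_average_sub_le (hind : iIndepFun Z μ)
    (hlaw : ∀ i, HasLaw (Z i) ν μ) {h : S → ℝ} (hh : Measurable h) {b : ℝ} (hb : ∀ z, |h z| ≤ b)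
    (hb0 : 0 < b) {ε : ℝ} (hε : 0 ≤ ε) :
    μ {ω | ε * Fintype.card V ≤ |∑ j, (h (Z j ω) - ∫ z, h z ∂ν)|}
      ≤ ENNReal.ofReal (2 * Real.exp (-(ε ^ 2 * Fintype.card V) / (2 * b ^ 2))) := by
  rw [← ofReal_measureReal]
  refine ENNReal.ofReal_le_ofReal ?_
  refine (measureReal_le_abs_sum_sub_integral_le hind hlaw hh hb Finset.univ
    (by positivity)).trans (le_of_eq ?_)
  rw [Finset.card_univ]
  congr 2
  rcases (Nat.cast_nonneg (α := ℝ) (Fintype.card V)).eq_or_lt with h0 | h0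
  · simp [← h0]
  · field_simp

end Concentration

/-! ### Deterministic bounds for the bandwidth estimate -/

section Deterministic

variable {d n : ℕ}

/-- The weights of `W` between points at distance at most `r`. -/
noncomputable def truncatedWeight (σ r : ℝ) (x : Fin n → EuclideanSpace ℝ (Fin d)) :
    Matrix (Fin n) (Fin n) ℝ :=
  Matrix.of fun i j => if ‖x i - x j‖ ≤ r then weightMatrix σ x i j else 0

theorem truncatedWeight_comm (σ r : ℝ) (x : Fin n → EuclideanSpace ℝ (Fin d)) (i j : Fin n) :
    truncatedWeight σ r x i j = truncatedWeight σ r x j i := by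
  simp only [truncatedWeight, Matrix.of_apply, norm_sub_rev (x i), weightMatrix_comm σ x i]

theorem truncatedWeight_nonneg (σ r : ℝ) (x : Fin n → EuclideanSpace ℝ (Fin d)) (i j : Fin n) :
    0 ≤ truncatedWeight σ r x i j := by
  simp only [truncatedWeight, Matrix.of_apply]
  split_ifs
  exacts [weightMatrix_nonneg _ _ _ _, le_rfl]

theorem truncatedWeight_le (σ r : ℝ) (x : Fin n → EuclideanSpace ℝ (Fin d)) (i j : Fin n) :
    truncatedWeight σ r x i j ≤ weightMatrix σ x i j := by
  simp only [truncatedWeight, Matrix.of_apply]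
  split_ifs
  exacts [le_rfl, weightMatrix_nonneg _ _ _ _]

theorem weightMatrix_sub_truncatedWeight_le (σ : ℝ) {r : ℝ} (hr : 0 ≤ r)
    (x : Fin n → EuclideanSpace ℝ (Fin d)) (i j : Fin n) :
    weightMatrix σ x i j - truncatedWeight σ r x i j
      ≤ gaussianPeak d σ * Real.exp (-r ^ 2 / (2 * σ ^ 2)) := by
  have h0 : 0 ≤ gaussianPeak d σ * Real.exp (-r ^ 2 / (2 * σ ^ 2)) :=
    mul_nonneg (gaussianPeak_nonneg _ _) (Real.exp_nonneg _)
  simp only [truncatedWeight, Matrix.of_apply]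
  split_ifs with h
  · simpa using h0
  · rw [sub_zero, weightMatrix_apply]
    split_ifs
    · exact h0
    · exact gaussianKernel_le_of_le_norm hr (not_le.1 h).le

/-- The Laplacian of the weights between points at distance at most `r`. -/
noncomputable def truncatedLaplacian (σ r : ℝ) (x : Fin n → EuclideanSpace ℝ (Fin d)) :
    Matrix (Fin n) (Fin n) ℝ :=
  scaledLaplacian (1 / (Fintype.card (Fin n) : ℝ)) (truncatedWeight σ r x)

theorem posSemidef_truncatedLaplacian (σ r : ℝ) (x : Fin n → EuclideanSpace ℝ (Fin d)) :
    (truncatedLaplacian σ r x).PosSemidef :=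
  posSemidef_scaledLaplacian (by positivity) (truncatedWeight_comm σ r x)
    (truncatedWeight_nonneg σ r x)

/-- An entry of `L' v` can only be nonzero if `v` takes two values at distance at most `r`. -/
theorem exists_of_truncatedLaplacian_mulVec_ne_zero {σ r : ℝ}
    {x : Fin n → EuclideanSpace ℝ (Fin d)} {v : Fin n → ℝ} {i : Fin n}
    (h : (truncatedLaplacian σ r x *ᵥ v) i ≠ 0) : ∃ j, v i ≠ v j ∧ ‖x i - x j‖ ≤ r := by
  by_contra! hc
  refine h ?_
  rw [truncatedLaplacian, scaledLaplacian_mulVec_apply, Finset.sum_eq_zero, mul_zero]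
  intro j _
  by_cases hij : v i = v j
  · rw [hij, sub_self, mul_zero]
  · simp [truncatedWeight, not_le.2 (hc j hij)]

theorem truncatedLaplacian_mulVec_congr {σ r : ℝ}
    {x : Fin n → EuclideanSpace ℝ (Fin d)} {v v' : Fin n → ℝ} {i : Fin n} (hi : v i = v' i)
    (h : ∀ j, ‖x i - x j‖ ≤ r → v j = v' j) :
    (truncatedLaplacian σ r x *ᵥ v) i = (truncatedLaplacian σ r x *ᵥ v') i := by
  rw [truncatedLaplacian, scaledLaplacian_mulVec_apply, scaledLaplacian_mulVec_apply]
  congr 1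
  refine Finset.sum_congr rfl fun j _ => ?_
  by_cases hij : ‖x i - x j‖ ≤ r
  · rw [hi, h j hij]
  · simp [truncatedWeight, hij]

theorem dotProduct_truncatedLaplacian_le {σ r : ℝ} (hσ : 0 < σ)
    {x : Fin n → EuclideanSpace ℝ (Fin d)} {v : Fin n → ℝ} {θ : ℝ}
    (h : ∀ i, v i ≠ 0 → 1 / (n : ℝ) * ∑ j, weightMatrix σ x i j ≤ θ) :
    v ⬝ᵥ truncatedLaplacian σ r x *ᵥ v ≤ (θ + gaussianPeak d σ / n) * (v ⬝ᵥ v) := by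
  refine le_trans ?_ (dotProduct_graphLaplacian_le hσ x h)
  rw [graphLaplacian_eq_scaledLaplacian]
  exact dotProduct_scaledLaplacian_mono (by positivity) (truncatedWeight_comm σ r x)
    (weightMatrix_comm σ x) (truncatedWeight_le σ r x) v

/-- The powers of the truncated Laplacian spread the support of `L' g` by `r` at each step, so they
stay in the region where the density is little more than `s`, and there the degrees bound `L'`. -/
theorem norm_truncatedLaplacian_pow_mulVec_le {σ r : ℝ} (hσ : 0 < σ) (hr : 0 ≤ r)
    {x : Fin n → EuclideanSpace ℝ (Fin d)} {p : EuclideanSpace ℝ (Fin d) → ℝ} {K : NNReal}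
    (hp : LipschitzWith K p) {δ s : ℝ} (hδ : 0 ≤ δ) (hs : 0 ≤ s)
    (hdeg : ∀ i, 1 / (n : ℝ) * ∑ j, weightMatrix σ x i j ≤ p (x i) + δ) {g : Fin n → ℝ}
    (hg : ∀ i j, g i ≠ g j → ‖x i - x j‖ ≤ r → p (x i) ≤ s + K * r) {m k : ℕ} (hm : 0 < m)
    (hkm : k ≤ m) :
    ‖WithLp.toLp 2 ((truncatedLaplacian σ r x ^ k) *ᵥ g)‖
      ≤ (s + K * ((m + 1) * r) + δ + gaussianPeak d σ / n) ^ k * ‖WithLp.toLp 2 g‖ := by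
  set L' := truncatedLaplacian σ r x with hL'
  set θ := s + K * ((m + 1) * r) + δ + gaussianPeak d σ / n with hθ
  have hpeak := gaussianPeak_nonneg d σ
  have hKr : 0 ≤ K * r := mul_nonneg K.coe_nonneg hr
  have hθ0 : 0 ≤ θ := by positivity
  have hPSD : L'.PosSemidef := posSemidef_truncatedLaplacian σ r x
  have hlip : ∀ i j, ‖x i - x j‖ ≤ r → p (x j) ≤ p (x i) + K * r := by
    intro i j hij
    have h1 := hp.norm_sub_le (x j) (x i)
    have h2 := le_abs_self (p (x j) - p (x i))
    rw [Real.norm_eq_abs, norm_sub_rev] at h1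
    have h3 : K * ‖x i - x j‖ ≤ K * r := mul_le_mul_of_nonneg_left hij K.coe_nonneg
    linarith
  have hsupp : ∀ (k : ℕ) i, ((L' ^ (k + 1)) *ᵥ g) i ≠ 0 → p (x i) ≤ s + K * ((k + 1) * r) := by
    intro k
    induction k with
    | zero =>
      intro i hi
      rw [zero_add, pow_one] at hi
      obtain ⟨j, hj, hij⟩ := exists_of_truncatedLaplacian_mulVec_ne_zero hi
      simpa using hg i j hj hij
    | succ k ih =>
      intro i hi
      rw [pow_succ' L', ← Matrix.mulVec_mulVec] at hi
      obtain ⟨j, hj, hij⟩ := exists_of_truncatedLaplacian_mulVec_ne_zero hi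
      have h1 := hlip j i (by rwa [norm_sub_rev])
      push_cast
      by_cases hvi : ((L' ^ (k + 1)) *ᵥ g) i = 0
      · have h2 := ih j fun h => hj (hvi.trans h.symm)
        linarith
      · have h2 := ih i hvi
        linarith
  have hform : ∀ v : Fin n → ℝ, (∀ i, v i ≠ 0 → p (x i) ≤ s + K * ((m + 1) * r)) →
      v ⬝ᵥ L' *ᵥ v ≤ θ * (v ⬝ᵥ v) := fun v hv =>
    dotProduct_truncatedLaplacian_le hσ fun i hi => (hdeg i).trans (by linarith [hv i hi])
  have hm1 : (1 : ℝ) ≤ m := by exact_mod_cast hm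
  induction k with
  | zero => simp
  | succ k ih =>
    have hk1 : (k : ℝ) + 1 ≤ m := by exact_mod_cast hkm
    have hu : ∀ i, ((L' ^ (k + 1)) *ᵥ g) i ≠ 0 → p (x i) ≤ s + K * ((m + 1) * r) := fun i hi =>
      (hsupp k i hi).trans (by nlinarith)
    rcases Nat.eq_zero_or_pos k with hk | hk
    · -- The vector `g` is not supported in the low-density region, but `L' g` only sees its
      -- restriction `g'` to that region.
      subst hk
      rw [zero_add, pow_one] at hu ⊢
      rw [pow_one]
      set g' : Fin n → ℝ := fun i => if p (x i) ≤ s + K * (2 * r) then g i else 0 with hg'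
      have huv : (L' *ᵥ g) ⬝ᵥ (L' *ᵥ g) = (L' *ᵥ g) ⬝ᵥ L' *ᵥ g' := by
        refine Finset.sum_congr rfl fun i _ => ?_
        by_cases hi : (L' *ᵥ g) i = 0
        · rw [hi, zero_mul, zero_mul]
        congr 1
        have h1 : p (x i) ≤ s + K * r := by simpa using hsupp 0 i (by simpa using hi)
        refine truncatedLaplacian_mulVec_congr ?_ fun j hij => ?_
        · simp only [hg']; rw [if_pos (by linarith)]
        · have := hlip i j hij
          simp only [hg']; rw [if_pos (by linarith)]
      have h1 := hPSD.norm_mulVec_le hθ0 huv (hform _ hu) (hform g' fun i hi => by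
        have h2 : p (x i) ≤ s + K * (2 * r) := by
          by_contra h
          exact hi (by simp [hg', h])
        nlinarith)
      refine h1.trans (mul_le_mul_of_nonneg_left ?_ hθ0)
      refine (pow_le_pow_iff_left₀ (norm_nonneg _) (norm_nonneg _) two_ne_zero).1 ?_
      rw [norm_toLp_sq, norm_toLp_sq]
      refine Finset.sum_le_sum fun i _ => ?_
      simp only [hg']
      split_ifs
      · exact le_rfl
      · nlinarith [sq_nonneg (g i)]
    · obtain ⟨k, rfl⟩ := Nat.exists_eq_add_of_lt hk
      rw [zero_add] at *
      have hv : ∀ i, ((L' ^ (k + 1)) *ᵥ g) i ≠ 0 → p (x i) ≤ s + K * ((m + 1) * r) := fun i hi =>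
        (hsupp k i hi).trans (by push_cast at hk1; nlinarith)
      have h1 := hPSD.norm_mulVec_le hθ0 (u := (L' ^ (k + 1 + 1)) *ᵥ g)
        (v := (L' ^ (k + 1)) *ᵥ g) (by rw [Matrix.mulVec_mulVec, ← pow_succ' L'])
        (hform _ hu) (hform _ hv)
      calc _ ≤ _ := h1
        _ ≤ θ * (θ ^ (k + 1) * ‖WithLp.toLp 2 g‖) :=
          mul_le_mul_of_nonneg_left (ih (by omega)) hθ0
        _ = _ := by ring

/-- The deterministic upper bound. Truncating the weights at distance `r` changes `L^m` by at most
the tail term of `htail`; the truncated Laplacian only meets points where the density is at most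
`s + K (m + 1) r`. -/
theorem bandwidthEstimate_le {σ r : ℝ} (hσ : 0 < σ) (hr : 0 ≤ r)
    {x : Fin n → EuclideanSpace ℝ (Fin d)} {p : EuclideanSpace ℝ (Fin d) → ℝ} {K : NNReal}
    (hp : LipschitzWith K p) {δ s : ℝ} (hδ : 0 ≤ δ) (hs : 0 ≤ s)
    (hdeg : ∀ i, 1 / (n : ℝ) * ∑ j, weightMatrix σ x i j ≤ p (x i) + δ) {g : Fin n → ℝ}
    (hg : ∀ i j, g i ≠ g j → ‖x i - x j‖ ≤ r → p (x i) ≤ s + K * r) {m : ℕ} (hm : 0 < m)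
    {ε : ℝ} (hε : 0 ≤ ε)
    (htail : m * (2 * gaussianPeak d σ) ^ m * Real.exp (-r ^ 2 / (2 * σ ^ 2)) ≤ ε ^ m) :
    bandwidthEstimate (graphLaplacian σ x) m g
      ≤ s + K * ((m + 1) * r) + δ + gaussianPeak d σ / n + ε := by
  have hpeak := gaussianPeak_nonneg d σ
  set θ := s + K * ((m + 1) * r) + δ + gaussianPeak d σ / n with hθ
  have hθ0 : 0 ≤ θ := by have := K.coe_nonneg; positivity
  set L := graphLaplacian σ x with hL
  set L' := truncatedLaplacian σ r x with hL'
  set τ := Real.exp (-r ^ 2 / (2 * σ ^ 2)) with hτ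
  set a := ‖WithLp.toLp 2 g‖ with ha
  have ha0 : 0 ≤ a := norm_nonneg _
  have hLn : ∀ v, ‖WithLp.toLp 2 (L *ᵥ v)‖ ≤ 2 * gaussianPeak d σ * ‖WithLp.toLp 2 v‖ := by
    rw [hL, graphLaplacian_eq_scaledLaplacian]
    exact norm_scaledLaplacian_mulVec_le (weightMatrix_comm σ x) (weightMatrix_nonneg σ x)
      (weightMatrix_le σ x) hpeak
  have hLn' : ∀ v, ‖WithLp.toLp 2 (L' *ᵥ v)‖ ≤ 2 * gaussianPeak d σ * ‖WithLp.toLp 2 v‖ :=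
    norm_scaledLaplacian_mulVec_le (truncatedWeight_comm σ r x) (truncatedWeight_nonneg σ r x)
      (fun i j => (truncatedWeight_le σ r x i j).trans (weightMatrix_le σ x i j)) hpeak
  have hLL' : ∀ v, ‖WithLp.toLp 2 ((L - L') *ᵥ v)‖
      ≤ 2 * (gaussianPeak d σ * τ) * ‖WithLp.toLp 2 v‖ := by
    have h1 : L - L' = scaledLaplacian (1 / (Fintype.card (Fin n) : ℝ))
        (weightMatrix σ x - truncatedWeight σ r x) := by
      rw [hL, graphLaplacian_eq_scaledLaplacian, hL', truncatedLaplacian, scaledLaplacian,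
        scaledLaplacian, scaledLaplacian, ← smul_sub]
      congr 1
      simp only [Matrix.sub_apply, Finset.sum_sub_distrib]
      rw [← Matrix.diagonal_sub]
      abel
    rw [h1]
    refine norm_scaledLaplacian_mulVec_le ?_ ?_ ?_ (by positivity)
    · intro i j
      rw [Matrix.sub_apply, Matrix.sub_apply, weightMatrix_comm, truncatedWeight_comm]
    · intro i j
      exact sub_nonneg.2 (truncatedWeight_le σ r x i j)
    · exact weightMatrix_sub_truncatedWeight_le σ hr x
  have hdiff := norm_pow_mulVec_sub_le (by positivity) (by positivity) hLn hLn' hLL' g (m - 1)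
  rw [Nat.sub_add_cancel hm] at hdiff
  have hcast : ((m - 1 : ℕ) : ℝ) + 1 = m := by
    rw [Nat.cast_sub hm]; push_cast; ring
  have hsmall : ((m - 1 : ℕ) + 1 : ℝ) * (2 * gaussianPeak d σ) ^ (m - 1)
      * (2 * (gaussianPeak d σ * τ)) ≤ ε ^ m := by
    refine le_trans (le_of_eq ?_) htail
    obtain ⟨m, rfl⟩ := Nat.exists_eq_add_of_lt hm
    simp only [zero_add, Nat.add_sub_cancel]
    push_cast
    ring
  have hmain := norm_truncatedLaplacian_pow_mulVec_le hσ hr hp hδ hs hdeg hg hm (le_refl m)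
  have hnum : g ⬝ᵥ (L ^ m) *ᵥ g ≤ (θ + ε) ^ m * (g ⬝ᵥ g) := by
    have h1 : g ⬝ᵥ (L ^ m) *ᵥ g
        = g ⬝ᵥ (L' ^ m) *ᵥ g + g ⬝ᵥ ((L ^ m) *ᵥ g - (L' ^ m) *ᵥ g) := by
      rw [← dotProduct_add]; congr 1; abel
    have h2 := (le_abs_self _).trans (abs_dotProduct_le_norm_mul_norm g ((L' ^ m) *ᵥ g))
    have h3 := (le_abs_self _).trans
      (abs_dotProduct_le_norm_mul_norm g ((L ^ m) *ᵥ g - (L' ^ m) *ᵥ g))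
    have h4 : a * ‖WithLp.toLp 2 ((L' ^ m) *ᵥ g)‖ ≤ a * (θ ^ m * a) :=
      mul_le_mul_of_nonneg_left hmain ha0
    have h5 : a * ‖WithLp.toLp 2 ((L ^ m) *ᵥ g - (L' ^ m) *ᵥ g)‖ ≤ a * (ε ^ m * a) :=
      mul_le_mul_of_nonneg_left (hdiff.trans (mul_le_mul_of_nonneg_right hsmall ha0)) ha0
    have h6 : θ ^ m + ε ^ m ≤ (θ + ε) ^ m := pow_add_pow_le hθ0 hε hm.ne'
    rw [← norm_toLp_sq]
    calc g ⬝ᵥ (L ^ m) *ᵥ g ≤ a * (θ ^ m * a) + a * (ε ^ m * a) := by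
          rw [h1]; exact add_le_add (h2.trans h4) (h3.trans h5)
      _ = (θ ^ m + ε ^ m) * a ^ 2 := by ring
      _ ≤ _ := mul_le_mul_of_nonneg_right h6 (by positivity)
  have hgg : 0 ≤ g ⬝ᵥ g := by rw [← norm_toLp_sq]; positivity
  have hratio : (g ⬝ᵥ (L ^ m) *ᵥ g) / (g ⬝ᵥ g) ≤ (θ + ε) ^ m := by
    rcases hgg.eq_or_lt with h0 | h0
    · rw [← h0, div_zero]; positivity
    · rwa [div_le_iff₀ h0]
  have hratio0 : 0 ≤ (g ⬝ᵥ (L ^ m) *ᵥ g) / (g ⬝ᵥ g) :=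
    div_nonneg ((posSemidef_graphLaplacian σ x).dotProduct_pow_mulVec_nonneg g m) hgg
  calc bandwidthEstimate L m g ≤ ((θ + ε) ^ m) ^ (1 / (m : ℝ)) :=
        Real.rpow_le_rpow hratio0 hratio (by positivity)
    _ = θ + ε := by
        rw [one_div, Real.pow_rpow_inv_natCast (by positivity) hm.ne']

theorem norm_toLp_le_mul_sqrt {v : Fin n → ℝ} {e : ℝ} (he : 0 ≤ e) (h : ∀ i, |v i| ≤ e) :
    ‖WithLp.toLp 2 v‖ ≤ e * √n := by
  refine (pow_le_pow_iff_left₀ (norm_nonneg _) (by positivity) two_ne_zero).1 ?_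
  rw [norm_toLp_sq, mul_pow, Real.sq_sqrt (Nat.cast_nonneg n)]
  calc v ⬝ᵥ v ≤ ∑ _i : Fin n, e ^ 2 := Finset.sum_le_sum fun i _ => by
        rw [← pow_two, ← sq_abs]; exact pow_le_pow_left₀ (abs_nonneg _) (h i) 2
    _ = _ := by simp [mul_comm]

/-- If the averages over neighbours of `1`, `g` and `p^k (g - a)` are close to `p`, `p a` and `0`,
then `L^k g` is close to `p^k (g - a)`: here `g - a` is the part of `g` that averaging kills. -/
theorem norm_graphLaplacian_pow_mulVec_sub_le {σ : ℝ} (hσ : 0 < σ)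
    {x : Fin n → EuclideanSpace ℝ (Fin d)} {p a g : Fin n → ℝ} {δ R : ℝ} (hδ : 0 ≤ δ)
    (hR : 1 ≤ R) (hp0 : ∀ i, 0 ≤ p i) (hpR : ∀ i, p i + δ + gaussianPeak d σ / n ≤ R)
    (hga : ∀ i, |g i - a i| ≤ 1) (hg1 : ∀ i, |g i| ≤ 1) {M : ℕ}
    (hdeg : ∀ i, |1 / (n : ℝ) * ∑ j, weightMatrix σ x i j - p i| ≤ δ)
    (hg : ∀ i, |1 / (n : ℝ) * ∑ j, weightMatrix σ x i j * g j - p i * a i| ≤ δ)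
    (hpow : ∀ k, 1 ≤ k → k < M → ∀ i,
      |1 / (n : ℝ) * ∑ j, weightMatrix σ x i j * (p j ^ k * (g j - a j))| ≤ δ)
    {k : ℕ} (hk : 1 ≤ k) (hkM : k ≤ M) :
    ‖WithLp.toLp 2 ((graphLaplacian σ x ^ k) *ᵥ g - fun i => p i ^ k * (g i - a i))‖
      ≤ 2 * k * δ * R ^ k * √n := by
  set L := graphLaplacian σ x with hL
  have hpeak : 0 ≤ gaussianPeak d σ / n := div_nonneg (gaussianPeak_nonneg d σ) (Nat.cast_nonneg n)
  have happly : ∀ (v : Fin n → ℝ) i, (L *ᵥ v) i = (1 / (n : ℝ) * ∑ j, weightMatrix σ x i j) * v i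
      - 1 / (n : ℝ) * ∑ j, weightMatrix σ x i j * v j := by
    intro v i
    rw [hL, graphLaplacian_eq_scaledLaplacian, scaledLaplacian_mulVec_apply, Fintype.card_fin]
    simp only [mul_sub, Finset.sum_sub_distrib, Finset.sum_mul, Finset.mul_sum, mul_assoc]
  have hnorm : ∀ v, ‖WithLp.toLp 2 (L *ᵥ v)‖ ≤ R * ‖WithLp.toLp 2 v‖ := by
    refine (posSemidef_graphLaplacian σ x).norm_mulVec_le_of_forall (by linarith) fun v => ?_
    have h1 := dotProduct_graphLaplacian_le hσ x (v := v) (θ := R - gaussianPeak d σ / n)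
      fun i _ => by linarith [(abs_le.1 (hdeg i)).2, hpR i]
    simpa using h1
  induction k, hk using Nat.le_induction with
  | base =>
    refine (norm_toLp_le_mul_sqrt (e := 2 * δ) (by positivity) fun i => ?_).trans ?_
    · rw [Pi.sub_apply, pow_one, happly]
      have h1 : |(1 / (n : ℝ) * ∑ j, weightMatrix σ x i j - p i) * g i| ≤ δ := by
        rw [abs_mul]
        exact (mul_le_mul (hdeg i) (hg1 i) (abs_nonneg _) hδ).trans (by simp)
      have h2 := abs_sub ((1 / (n : ℝ) * ∑ j, weightMatrix σ x i j - p i) * g i)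
        (1 / (n : ℝ) * ∑ j, weightMatrix σ x i j * g j - p i * a i)
      refine le_trans (le_of_eq ?_) (h2.trans (by linarith [hg i]))
      congr 1
      ring
    · have h1 : 2 * δ ≤ 2 * (1 : ℕ) * δ * R ^ 1 := by push_cast; nlinarith
      exact mul_le_mul_of_nonneg_right h1 (Real.sqrt_nonneg _)
  | succ k hk ih =>
    set v : Fin n → ℝ := fun i => p i ^ k * (g i - a i) with hv
    have hsplit : (L ^ (k + 1)) *ᵥ g - (fun i => p i ^ (k + 1) * (g i - a i))
        = L *ᵥ ((L ^ k) *ᵥ g - v) + (L *ᵥ v - fun i => p i ^ (k + 1) * (g i - a i)) := by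
      rw [pow_succ' L, ← Matrix.mulVec_mulVec, Matrix.mulVec_sub]
      abel
    have hRk : 1 ≤ R ^ k := one_le_pow₀ hR
    have h2 : ‖WithLp.toLp 2 (L *ᵥ v - fun i => p i ^ (k + 1) * (g i - a i))‖
        ≤ 2 * δ * R ^ k * √n := by
      refine norm_toLp_le_mul_sqrt (by positivity) fun i => ?_
      rw [Pi.sub_apply, happly]
      have hvi : |v i| ≤ R ^ k := by
        rw [hv, abs_mul, abs_of_nonneg (pow_nonneg (hp0 i) k)]
        have h3 : p i ^ k ≤ R ^ k := pow_le_pow_left₀ (hp0 i) (by linarith [hpR i]) k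
        exact (mul_le_mul h3 (hga i) (abs_nonneg _) (by positivity)).trans (by simp)
      have h3 : |(1 / (n : ℝ) * ∑ j, weightMatrix σ x i j - p i) * v i| ≤ δ * R ^ k := by
        rw [abs_mul]
        exact mul_le_mul (hdeg i) hvi (abs_nonneg _) hδ
      have h4 := hpow k hk (by omega) i
      have h5 := abs_sub ((1 / (n : ℝ) * ∑ j, weightMatrix σ x i j - p i) * v i)
        (1 / (n : ℝ) * ∑ j, weightMatrix σ x i j * v j)
      have h6 : δ ≤ δ * R ^ k := le_mul_of_one_le_right hδ hRk
      refine le_trans (le_of_eq ?_) (h5.trans (by simp only [hv] at h4 h3 ⊢; linarith))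
      congr 1
      simp only [hv]
      ring
    rw [hsplit, WithLp.toLp_add]
    refine (norm_add_le _ _).trans ?_
    have h1 := (hnorm ((L ^ k) *ᵥ g - v)).trans
      (mul_le_mul_of_nonneg_left (ih (by omega)) (by linarith))
    refine (add_le_add h1 h2).trans ?_
    have h7 : 2 * δ * R ^ k * √n ≤ 2 * δ * R ^ (k + 1) * √n := by
      gcongr
      omega
    calc _ ≤ R * (2 * k * δ * R ^ k * √n) + 2 * δ * R ^ (k + 1) * √n := by linarith
      _ = _ := by push_cast; ring

/-- The deterministic lower bound. As the estimate increases with its order, a fixed order `M ≤ m`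
suffices, and `gᵀ L^M g` is close to `∑ i, g i * p i ^ M * (g i - a i)`. -/
theorem le_bandwidthEstimate {σ : ℝ} (hσ : 0 < σ)
    {x : Fin n → EuclideanSpace ℝ (Fin d)} {p a g : Fin n → ℝ} {δ R : ℝ} (hδ : 0 ≤ δ)
    (hR : 1 ≤ R) (hp0 : ∀ i, 0 ≤ p i) (hpR : ∀ i, p i + δ + gaussianPeak d σ / n ≤ R)
    (ha : ∀ i, 0 ≤ a i ∧ a i ≤ 1) (hg01 : ∀ i, g i = 0 ∨ g i = 1) {M : ℕ} (hM : 0 < M)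
    (hdeg : ∀ i, |1 / (n : ℝ) * ∑ j, weightMatrix σ x i j - p i| ≤ δ)
    (hg : ∀ i, |1 / (n : ℝ) * ∑ j, weightMatrix σ x i j * g j - p i * a i| ≤ δ)
    (hpow : ∀ k, 1 ≤ k → k < M → ∀ i,
      |1 / (n : ℝ) * ∑ j, weightMatrix σ x i j * (p j ^ k * (g j - a j))| ≤ δ)
    {t : ℝ} (ht : 0 < t) (hn : 0 < n)
    (hsum : (t ^ M + 2 * M * δ * R ^ M) * n ≤ ∑ i, g i * (p i ^ M * (g i - a i)))
    {m : ℕ} (hMm : M ≤ m) :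
    t ≤ bandwidthEstimate (graphLaplacian σ x) m g := by
  have hg1 : ∀ i, |g i| ≤ 1 := fun i => by rcases hg01 i with h | h <;> simp [h]
  have hga : ∀ i, |g i - a i| ≤ 1 := fun i => by
    have := ha i
    rcases hg01 i with h | h <;> rw [h, abs_le] <;> constructor <;> linarith
  have hn' : (0 : ℝ) < n := by exact_mod_cast hn
  have h1 := norm_graphLaplacian_pow_mulVec_sub_le hσ hδ hR hp0 hpR hga hg1 hdeg hg hpow hM le_rfl
  set L := graphLaplacian σ x with hL
  set v : Fin n → ℝ := fun i => p i ^ M * (g i - a i) with hv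
  have hgn : ‖WithLp.toLp 2 g‖ ≤ √n := by
    simpa using norm_toLp_le_mul_sqrt zero_le_one hg1
  have h2 : |g ⬝ᵥ ((L ^ M) *ᵥ g - v)| ≤ 2 * M * δ * R ^ M * n := by
    have hR0 : 0 ≤ R := by linarith
    refine (abs_dotProduct_le_norm_mul_norm _ _).trans ?_
    calc _ ≤ √n * (2 * M * δ * R ^ M * √n) :=
          mul_le_mul hgn h1 (norm_nonneg _) (Real.sqrt_nonneg _)
      _ = 2 * M * δ * R ^ M * (√n * √n) := by ring
      _ = _ := by rw [Real.mul_self_sqrt hn'.le]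
  have h3 : t ^ M * n ≤ g ⬝ᵥ (L ^ M) *ᵥ g := by
    have h4 : g ⬝ᵥ (L ^ M) *ᵥ g = g ⬝ᵥ v + g ⬝ᵥ ((L ^ M) *ᵥ g - v) := by
      rw [← dotProduct_add]; congr 1; abel
    have h5 : g ⬝ᵥ v = ∑ i, g i * (p i ^ M * (g i - a i)) := rfl
    have h6 := (abs_le.1 h2).1
    rw [h4, h5]
    linarith
  have hggn : g ⬝ᵥ g ≤ n := by
    rw [← norm_toLp_sq]
    calc _ ≤ √(n : ℝ) ^ 2 := pow_le_pow_left₀ (norm_nonneg _) hgn 2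
      _ = n := Real.sq_sqrt hn'.le
  have hgg : 0 < g ⬝ᵥ g := by
    have hgg0 : 0 ≤ g ⬝ᵥ g := by rw [← norm_toLp_sq]; positivity
    refine hgg0.lt_of_ne fun h0 => ?_
    have hg0 : g = 0 := dotProduct_self_eq_zero.1 h0.symm
    rw [hg0, zero_dotProduct] at h3
    have : 0 < t ^ M * n := by positivity
    linarith
  have h4 : t ^ M ≤ (g ⬝ᵥ (L ^ M) *ᵥ g) / (g ⬝ᵥ g) := by
    rw [le_div_iff₀ hgg]
    exact (mul_le_mul_of_nonneg_left hggn (by positivity)).trans h3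
  calc t = (t ^ M) ^ (1 / (M : ℝ)) := by rw [one_div, Real.pow_rpow_inv_natCast ht.le hM.ne']
    _ ≤ ((g ⬝ᵥ (L ^ M) *ᵥ g) / (g ⬝ᵥ g)) ^ (1 / (M : ℝ)) :=
        Real.rpow_le_rpow (by positivity) h4 (by positivity)
    _ ≤ _ := (posSemidef_graphLaplacian σ x).rpow_moment_mono g hM hMm

end Deterministic

/-! ### The densities and the law of a labelled point -/

section Densities

variable {d : ℕ} {ι : Type*}

theorem IsRegularDensity.continuous {f : EuclideanSpace ℝ (Fin d) → ℝ} (hf : IsRegularDensity f) :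
    Continuous f := hf.differentiable.continuous

theorem integrable_withDensity_prod_dirac [MeasurableSpace ι] {f : EuclideanSpace ℝ (Fin d) → ℝ}
    (hf : IsRegularDensity f) (i : ι) {φ : EuclideanSpace ℝ (Fin d) × ι → ℝ} (hφ : Measurable φ)
    {b : ℝ} (hb : ∀ z, |φ z| ≤ b) :
    Integrable φ ((volume.withDensity fun x => ENNReal.ofReal (f x)).prod (Measure.dirac i)) := by
  have : IsFiniteMeasure (volume.withDensity fun x => ENNReal.ofReal (f x)) :=
    isFiniteMeasure_withDensity_ofReal hf.integrable.2
  exact Integrable.of_bound hφ.aestronglyMeasurable b (ae_of_all _ hb)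

theorem integral_withDensity_prod_dirac [MeasurableSpace ι] {f : EuclideanSpace ℝ (Fin d) → ℝ}
    (hf : IsRegularDensity f) (i : ι) {φ : EuclideanSpace ℝ (Fin d) × ι → ℝ} (hφ : Measurable φ) :
    ∫ z, φ z ∂((volume.withDensity fun x => ENNReal.ofReal (f x)).prod (Measure.dirac i))
      = ∫ x, f x * φ (x, i) := by
  rw [Measure.prod_dirac, integral_map (by fun_prop) hφ.aestronglyMeasurable,
    integral_withDensity_eq_integral_toReal_smul hf.continuous.measurable.ennreal_ofReal
      (ae_of_all _ fun _ => ENNReal.ofReal_lt_top)]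
  refine integral_congr_ae (ae_of_all _ fun x => ?_)
  simp [ENNReal.toReal_ofReal (hf.nonneg x)]

variable [Fintype ι]

/-- Integration against the law of a labelled point. -/
theorem integral_labelledMixture [MeasurableSpace ι] {α : ι → ℝ} (hα : ∀ i, 0 ≤ α i)
    {f : ι → EuclideanSpace ℝ (Fin d) → ℝ} (hf : ∀ i, IsRegularDensity (f i))
    {φ : EuclideanSpace ℝ (Fin d) × ι → ℝ} (hφ : Measurable φ) {b : ℝ} (hb : ∀ z, |φ z| ≤ b) :
    ∫ z, φ z ∂(labelledMixture α f) = ∫ x, ∑ i, α i * f i x * φ (x, i) := by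
  have hint : ∀ i, Integrable (fun x => α i * f i x * φ (x, i)) := by
    intro i
    simp only [mul_comm _ (φ _)]
    refine ((hf i).integrable.const_mul _).bdd_mul (c := b) ?_ (ae_of_all _ fun x => hb _)
    exact (hφ.comp (by fun_prop : Measurable fun x => (x, i))).aestronglyMeasurable
  rw [labelledMixture, integral_finsetSum_measure fun i _ =>
      (integrable_withDensity_prod_dirac (hf i) i hφ hb).smul_measure ENNReal.ofReal_ne_top,
    integral_finsetSum _ fun i _ => hint i]
  refine Finset.sum_congr rfl fun i _ => ?_
  rw [integral_smul_measure, integral_withDensity_prod_dirac (hf i) i hφ,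
    ENNReal.toReal_ofReal (hα i), smul_eq_mul, ← integral_const_mul]
  simp only [mul_assoc]

/-- A labelled point almost surely lies where the weighted density of its class is positive. -/
theorem ae_labelledMixture_pos [MeasurableSpace ι] [MeasurableSingletonClass ι] {α : ι → ℝ}
    {f : ι → EuclideanSpace ℝ (Fin d) → ℝ} (hf : ∀ i, IsRegularDensity (f i)) :
    ∀ᵐ z ∂(labelledMixture α f), 0 < α z.2 * f z.2 z.1 := by
  have hset : MeasurableSet
      {z : EuclideanSpace ℝ (Fin d) × ι | 0 < α z.2 * f z.2 z.1} :=
    measurableSet_lt measurable_const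
      (measurable_from_prod_countable_left fun i => (hf i).continuous.measurable.const_mul (α i))
  rw [labelledMixture, ae_finsetSum_measure_iff]
  intro i _
  rcases le_or_gt (α i) 0 with h0 | h0
  · simp [ENNReal.ofReal_of_nonpos h0]
  refine Measure.ae_smul_measure ?_ _
  rw [Measure.prod_dirac, ae_map_iff (by fun_prop) hset,
    ae_withDensity_iff (hf i).continuous.measurable.ennreal_ofReal]
  refine ae_of_all _ fun x hx => ?_
  have : 0 < f i x := by simpa using hx
  positivity

variable [DecidableEq ι] {α : ι → ℝ} {f : ι → EuclideanSpace ℝ (Fin d) → ℝ} {A : ι}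

theorem one_sub_mul_complDensity (hA : α A < 1) (x : EuclideanSpace ℝ (Fin d)) :
    (1 - α A) * complDensity α f A x = ∑ i ∈ Finset.univ.erase A, α i * f i x := by
  rw [complDensity, mul_div_cancel₀]
  linarith

theorem mixtureDensity_eq_sum (hA : α A < 1) (x : EuclideanSpace ℝ (Fin d)) :
    mixtureDensity α f A x = ∑ i, α i * f i x := by
  rw [mixtureDensity, one_sub_mul_complDensity hA, 
    Finset.add_sum_erase _ (fun i => α i * f i x) (Finset.mem_univ A)]

theorem complDensity_nonneg (hα : ∀ i, 0 ≤ α i) (hf : ∀ i, IsRegularDensity (f i)) (hA : α A < 1)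
    (x : EuclideanSpace ℝ (Fin d)) : 0 ≤ complDensity α f A x :=
  div_nonneg (Finset.sum_nonneg fun i _ => mul_nonneg (hα i) ((hf i).nonneg x)) (by linarith)

theorem continuous_complDensity (hf : ∀ i, IsRegularDensity (f i)) :
    Continuous (complDensity α f A) := by
  unfold complDensity
  exact (continuous_finsetSum _ fun i _ => (hf i).continuous.const_mul _).div_const _

theorem continuous_mixtureDensity (hf : ∀ i, IsRegularDensity (f i)) :
    Continuous (mixtureDensity α f A) :=
  ((hf A).continuous.const_mul _).add ((continuous_complDensity hf).const_mul _)

theorem mixtureDensity_nonneg (hα : ∀ i, 0 ≤ α i) (hf : ∀ i, IsRegularDensity (f i))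
    (hA : α A < 1) (x : EuclideanSpace ℝ (Fin d)) : 0 ≤ mixtureDensity α f A x := by
  rw [mixtureDensity_eq_sum hA]
  exact Finset.sum_nonneg fun i _ => mul_nonneg (hα i) ((hf i).nonneg x)

theorem mul_le_mixtureDensity (hα : ∀ i, 0 ≤ α i) (hf : ∀ i, IsRegularDensity (f i))
    (hA : α A < 1) (x : EuclideanSpace ℝ (Fin d)) : α A * f A x ≤ mixtureDensity α f A x := by
  rw [mixtureDensity]
  have := mul_nonneg (by linarith : 0 ≤ 1 - α A) (complDensity_nonneg hα hf hA x)
  linarith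

theorem exists_mixtureDensity_le (hα : ∀ i, 0 ≤ α i) (hf : ∀ i, IsRegularDensity (f i))
    (hA : α A < 1) : ∃ B, ∀ x, mixtureDensity α f A x ≤ B := by
  choose B hB using fun i => (hf i).bounded
  refine ⟨∑ i, α i * B i, fun x => ?_⟩
  rw [mixtureDensity_eq_sum hA]
  exact Finset.sum_le_sum fun i _ => mul_le_mul_of_nonneg_left (hB i x) (hα i)

theorem exists_lipschitzWith_const_mul {g : EuclideanSpace ℝ (Fin d) → ℝ}
    (hg : IsRegularDensity g) (a : ℝ) : ∃ K, LipschitzWith K fun x => a * g x := by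
  obtain ⟨K, hK⟩ := hg.lipschitz
  exact ⟨_, ((lipschitzWith_smul a).comp hK)⟩

theorem exists_lipschitzWith_sum {J : Type*} (s : Finset J)
    {g : J → EuclideanSpace ℝ (Fin d) → ℝ} (hg : ∀ i ∈ s, ∃ K, LipschitzWith K (g i)) :
    ∃ K, LipschitzWith K fun x => ∑ i ∈ s, g i x := by
  classical
  induction s using Finset.induction_on with
  | empty => exact ⟨0, by simp⟩
  | insert a s ha ih =>
    obtain ⟨K, hK⟩ := ih fun i hi => hg i (Finset.mem_insert_of_mem hi)
    obtain ⟨K', hK'⟩ := hg a (Finset.mem_insert_self a s)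
    simp only [Finset.sum_insert ha]
    exact ⟨_, hK'.add hK⟩

theorem exists_lipschitzWith_mixtureDensity (hf : ∀ i, IsRegularDensity (f i)) (hA : α A < 1) :
    ∃ K, LipschitzWith K (mixtureDensity α f A) := by
  obtain ⟨K, hK⟩ := exists_lipschitzWith_sum Finset.univ fun i _ =>
    exists_lipschitzWith_const_mul (hf i) (α i)
  exact ⟨K, by simpa only [← mixtureDensity_eq_sum hA] using hK⟩

theorem integrable_mixtureDensity (hf : ∀ i, IsRegularDensity (f i)) (hA : α A < 1) :
    Integrable (mixtureDensity α f A) := by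
  have : mixtureDensity α f A = fun x => ∑ i, α i * f i x :=
    funext fun x => mixtureDensity_eq_sum hA x
  rw [this]
  exact integrable_finsetSum _ fun i _ => (hf i).integrable.const_mul _

/-- On a segment joining a point of `{u > 0}` to a point of `{v > 0}`, either these two open sets
meet, or they leave a point uncovered since the segment is connected. -/
theorem exists_mem_segment_pos_or_eq_zero {u v : EuclideanSpace ℝ (Fin d) → ℝ}
    (hu : Continuous u) (hv : Continuous v) (hu0 : ∀ x, 0 ≤ u x) (hv0 : ∀ x, 0 ≤ v x)
    {x y : EuclideanSpace ℝ (Fin d)} (hx : 0 < u x) (hy : 0 < v y) :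
    ∃ z ∈ segment ℝ x y, (0 < u z * v z) ∨ (u z = 0 ∧ v z = 0) := by
  by_contra! hc
  have hconn : IsPreconnected (segment ℝ x y) := (convex_segment x y).isPreconnected
  obtain ⟨z, hz, hz1, hz2⟩ := hconn {z | 0 < u z} {z | 0 < v z}
    (isOpen_lt continuous_const hu) (isOpen_lt continuous_const hv)
    (fun z hz => by
      rcases (hu0 z).eq_or_lt with h | h
      · exact Or.inr ((hv0 z).lt_of_ne fun h' => (hc z hz).2 h.symm h'.symm)
      · exact Or.inl h)
    ⟨x, left_mem_segment ℝ x y, hx⟩ ⟨y, right_mem_segment ℝ x y, hy⟩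
  exact absurd (hc z hz).1 (not_le.2 (mul_pos hz1 hz2))

/-- Two points of opposite classes that are close to each other lie where the density exceeds its
supremum over the overlap region by little. -/
theorem mixtureDensity_le_of_norm_sub_le (hα : ∀ i, 0 ≤ α i) (hf : ∀ i, IsRegularDensity (f i))
    (hA : α A < 1) {K : NNReal} (hK : LipschitzWith K (mixtureDensity α f A)) {r : ℝ}
    {x y : EuclideanSpace ℝ (Fin d)} (hxy : ‖x - y‖ ≤ r) (hx : 0 < f A x)
    (hy : 0 < complDensity α f A y) :
    mixtureDensity α f A x ≤ sSup (mixtureDensity α f A '' overlapRegion α f A) + K * r ∧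
      mixtureDensity α f A y ≤ sSup (mixtureDensity α f A '' overlapRegion α f A) + K * r := by
  obtain ⟨z, hz, hzc⟩ := exists_mem_segment_pos_or_eq_zero (hf A).continuous
    (continuous_complDensity hf) (hf A).nonneg (complDensity_nonneg hα hf hA) hx hy
  have hpz : mixtureDensity α f A z ≤ sSup (mixtureDensity α f A '' overlapRegion α f A) := by
    rcases hzc with h | ⟨h1, h2⟩
    · refine le_csSup ?_ ⟨z, h, rfl⟩
      obtain ⟨B, hB⟩ := exists_mixtureDensity_le (α := α) hα hf hA
      exact ⟨B, by rintro _ ⟨w, -, rfl⟩; exact hB w⟩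
    · have h3 : mixtureDensity α f A z = 0 := by simp [mixtureDensity, h1, h2]
      rw [h3]
      refine Real.sSup_nonneg ?_
      rintro _ ⟨w, -, rfl⟩
      exact mixtureDensity_nonneg hα hf hA w
  have hlip : ∀ w, ‖w - z‖ ≤ r → mixtureDensity α f A w ≤ mixtureDensity α f A z + K * r := by
    intro w hw
    have h1 := hK.norm_sub_le w z
    have h2 := le_abs_self (mixtureDensity α f A w - mixtureDensity α f A z)
    rw [Real.norm_eq_abs] at h1
    have h3 : K * ‖w - z‖ ≤ K * r := mul_le_mul_of_nonneg_left hw K.coe_nonneg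
    linarith
  have h1 : ‖x - z‖ ≤ r := by
    have := norm_sub_le_of_mem_segment hz
    rw [norm_sub_rev z, norm_sub_rev y] at this
    exact this.trans hxy
  have h2 : ‖y - z‖ ≤ r := by
    rw [segment_symm] at hz
    have := norm_sub_le_of_mem_segment hz
    rw [norm_sub_rev z] at this
    exact this.trans hxy
  exact ⟨(hlip x h1).trans (by linarith), (hlip y h2).trans (by linarith)⟩

/-- The conditional probability `α_A p_A / p` that a point at `x` belongs to the class `A`; it is
`0` where `p` vanishes. -/
noncomputable def classPosterior (α : ι → ℝ) (f : ι → EuclideanSpace ℝ (Fin d) → ℝ) (A : ι)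
    (x : EuclideanSpace ℝ (Fin d)) : ℝ :=
  α A * f A x / mixtureDensity α f A x

theorem classPosterior_nonneg (hα : ∀ i, 0 ≤ α i) (hf : ∀ i, IsRegularDensity (f i)) (hA : α A < 1)
    (x : EuclideanSpace ℝ (Fin d)) : 0 ≤ classPosterior α f A x :=
  div_nonneg (mul_nonneg (hα A) ((hf A).nonneg x)) (mixtureDensity_nonneg hα hf hA x)

theorem classPosterior_le_one (hα : ∀ i, 0 ≤ α i) (hf : ∀ i, IsRegularDensity (f i)) (hA : α A < 1)
    (x : EuclideanSpace ℝ (Fin d)) : classPosterior α f A x ≤ 1 :=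
  div_le_one_of_le₀ (mul_le_mixtureDensity hα hf hA x) (mixtureDensity_nonneg hα hf hA x)

theorem mixtureDensity_mul_classPosterior (hα : ∀ i, 0 ≤ α i) (hf : ∀ i, IsRegularDensity (f i))
    (hA : α A < 1) (x : EuclideanSpace ℝ (Fin d)) :
    mixtureDensity α f A x * classPosterior α f A x = α A * f A x := by
  rw [classPosterior]
  refine mul_div_cancel_of_imp' fun h => ?_
  have h1 := mul_le_mixtureDensity hα hf hA x
  have h2 := mul_nonneg (hα A) ((hf A).nonneg x)
  linarith

theorem measurable_classPosterior (hf : ∀ i, IsRegularDensity (f i)) :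
    Measurable (classPosterior α f A) :=
  ((hf A).continuous.measurable.const_mul _).div (continuous_mixtureDensity hf).measurable

end Densities

/-! ### Averages over the neighbours of a data point -/

section Averages

theorem measurable_gaussianKernel_fst_fst {d : ℕ} {ι : Type*} [MeasurableSpace ι] (σ : ℝ) :
    Measurable fun w : (EuclideanSpace ℝ (Fin d) × ι) × (EuclideanSpace ℝ (Fin d) × ι) =>
      gaussianKernel σ w.1.1 w.2.1 := by
  simp only [gaussianKernel_eq]
  fun_prop

variable {d : ℕ} {ι : Type*} [Fintype ι] [MeasurableSpace ι]
  {α : ι → ℝ} {f : ι → EuclideanSpace ℝ (Fin d) → ℝ}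

theorem tendsto_mul_exp_neg_mul_sqrt {c : ℝ} (hc : 0 < c) :
    Tendsto (fun n : ℕ => (n : ℝ) * (2 * Real.exp (-(c * √n)))) atTop (𝓝 0) := by
  have h1 := (Real.tendsto_pow_mul_exp_neg_atTop_nhds_zero 2).comp
    ((Real.tendsto_sqrt_atTop.comp tendsto_natCast_atTop_atTop).const_mul_atTop hc)
  have h2 := h1.const_mul (2 / c ^ 2)
  rw [mul_zero] at h2
  refine h2.congr fun n => ?_
  simp only [Function.comp_apply, mul_pow, Real.sq_sqrt (Nat.cast_nonneg n)]
  field_simp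

theorem tendsto_gaussianPeak_div {κ : Type*} {l : Filter κ} {n : κ → ℕ} {σ : κ → ℝ}
    (hn : Tendsto n l atTop) (hpeak : ∀ᶠ k in l, gaussianPeak d (σ k) ^ 4 ≤ n k) :
    Tendsto (fun k => gaussianPeak d (σ k) / n k) l (𝓝 0) := by
  have hn' : Tendsto (fun k => (n k : ℝ)) l atTop := tendsto_natCast_atTop_atTop.comp hn
  have h1 : Tendsto (fun k => (2 * (n k : ℝ))⁻¹ + (2 * √(n k : ℝ))⁻¹) l (𝓝 0) := by
    have h2 := (hn'.const_mul_atTop (two_pos (α := ℝ))).inv_tendsto_atTop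
    have h3 := ((Real.tendsto_sqrt_atTop.comp hn').const_mul_atTop
      (two_pos (α := ℝ))).inv_tendsto_atTop
    simpa using h2.add h3
  refine squeeze_zero' (Eventually.of_forall fun k =>
    div_nonneg (gaussianPeak_nonneg _ _) (Nat.cast_nonneg _)) ?_ h1
  filter_upwards [hpeak, hn.eventually_ge_atTop 1] with k hk hk1
  set q := gaussianPeak d (σ k)
  have hpos : (0 : ℝ) < n k := by exact_mod_cast hk1
  have h2 : q ^ 2 ≤ √(n k : ℝ) := Real.le_sqrt_of_sq_le (by linarith [hk, (by ring : (q ^ 2) ^ 2 = q ^ 4)])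
  have h3 : q ≤ (1 + √(n k : ℝ)) / 2 := by nlinarith [sq_nonneg (q - 1)]
  have h4 : 0 < √(n k : ℝ) := Real.sqrt_pos.2 hpos
  calc q / n k ≤ (1 + √(n k : ℝ)) / 2 / n k := by gcongr
    _ = (2 * (n k : ℝ))⁻¹ + √(n k : ℝ) / (2 * (√(n k : ℝ) * √(n k : ℝ))) := by
      rw [Real.mul_self_sqrt hpos.le]
      field_simp
    _ = _ := by
      congr 1
      field_simp

variable {Ω : Type*} [MeasurableSpace Ω] {μ : Measure Ω} [IsProbabilityMeasure μ]
  {X : ℕ → Ω → EuclideanSpace ℝ (Fin d)} {Y : ℕ → Ω → ι}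

/-- Weighted averages `n⁻¹ ∑_j w_ij φ(X_j, Y_j)` over the neighbours converge uniformly in the base
point `X_i` to the density-weighted class average of `φ`, in probability. -/
theorem tendsto_measure_exists_lt_abs_weighted_average_sub (hα : ∀ i, 0 ≤ α i)
    (hf : ∀ i, IsRegularDensity (f i))
    (hlaw : ∀ i, HasLaw (fun ω => (X i ω, Y i ω)) (labelledMixture α f) μ)
    (hindep : iIndepFun (fun i ω => (X i ω, Y i ω)) μ)
    {φ : EuclideanSpace ℝ (Fin d) × ι → ℝ} (hφ : Measurable φ) {b : ℝ} (hb0 : 0 < b)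
    (hb : ∀ z, |φ z| ≤ b) {q : EuclideanSpace ℝ (Fin d) → ℝ}
    (hq : ∀ x, q x = ∑ i, α i * f i x * φ (x, i)) {K : NNReal} (hK : LipschitzWith K q)
    (hqint : Integrable q)
    {κ : Type*} {l : Filter κ} {n : κ → ℕ} {σ : κ → ℝ}
    (hn : Tendsto n l atTop) (hσ : Tendsto σ l (𝓝[>] 0))
    (hpeak : ∀ᶠ k in l, gaussianPeak d (σ k) ^ 4 ≤ n k) {δ : ℝ} (hδ : 0 < δ) :
    Tendsto (fun k => μ {ω | ∃ i : Fin (n k), δ < |1 / (n k : ℝ) *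
      ∑ j, weightMatrix (σ k) (fun i : Fin (n k) => X i ω) i j * φ (X j ω, Y j ω) - q (X i ω)|})
      l (𝓝 0) := by
  have hσ0 : Tendsto σ l (𝓝 0) := hσ.mono_right nhdsWithin_le_nhds
  have hσpos : ∀ᶠ k in l, 0 < σ k := hσ.eventually self_mem_nhdsWithin
  have hbias : ∀ᶠ k in l,
      K * (σ k * 2 ^ ((d : ℝ) / 2)) + b * (gaussianPeak d (σ k) / n k) < δ / 2 := by
    have h1 : Tendsto (fun k => K * (σ k * 2 ^ ((d : ℝ) / 2))
        + b * (gaussianPeak d (σ k) / n k)) l (𝓝 (K * (0 * 2 ^ ((d : ℝ) / 2)) + b * 0)) :=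
      ((hσ0.mul_const _).const_mul _).add ((tendsto_gaussianPeak_div hn hpeak).const_mul _)
    refine h1.eventually_lt_const ?_
    simp only [zero_mul, mul_zero, add_zero]
    positivity
  have hmaj : Tendsto (fun k => ENNReal.ofReal
      ((n k : ℝ) * (2 * Real.exp (-((δ / 2) ^ 2 / (2 * b ^ 2) * √(n k)))))) l (𝓝 0) := by
    have h1 := (tendsto_mul_exp_neg_mul_sqrt (c := (δ / 2) ^ 2 / (2 * b ^ 2))
      (by positivity)).comp hn
    simpa using ENNReal.tendsto_ofReal h1
  have : IsProbabilityMeasure (labelledMixture α f) := by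
    rw [← (hlaw 0).map_eq]
    exact Measure.isProbabilityMeasure_map (hlaw 0).aemeasurable
  refine tendsto_of_tendsto_of_tendsto_of_le_of_le' tendsto_const_nhds hmaj
    (Eventually.of_forall fun _ => zero_le) ?_
  filter_upwards [hbias, hσpos, hpeak, hn.eventually_ge_atTop 1] with k hbk hσk hpk hnk
  set N := n k with hN
  set s := σ k with hs
  have hN0 : (0 : ℝ) < N := by exact_mod_cast hnk
  have hp0 : 0 < gaussianPeak d s := gaussianPeak_pos d hσk
  set F : EuclideanSpace ℝ (Fin d) × ι → EuclideanSpace ℝ (Fin d) × ι → ℝ :=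
    fun z z' => gaussianKernel s z.1 z'.1 * φ z' with hF
  have hFm : Measurable (Function.uncurry F) :=
    (measurable_gaussianKernel_fst_fst s).mul (hφ.comp measurable_snd)
  have hFb : ∀ z z', |F z z'| ≤ gaussianPeak d s * b := by
    intro z z'
    rw [hF, abs_mul, abs_of_nonneg (gaussianKernel_nonneg _ _ _)]
    exact mul_le_mul (gaussianKernel_le _ _ _) (hb _) (abs_nonneg _) hp0.le
  have hFint : ∀ z, ∫ z', F z z' ∂(labelledMixture α f) = ∫ y, gaussianKernel s z.1 y * q y := by
    intro z
    rw [integral_labelledMixture hα hf (φ := F z) hFm.of_uncurry_left (hFb z)]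
    refine integral_congr_ae (ae_of_all _ fun y => ?_)
    simp only [hF, hq, Finset.mul_sum]
    exact Finset.sum_congr rfl fun i _ => by ring
  have hconc := measure_exists_le_abs_average_erase_sub_le (V := Fin N)
    (Z := fun i ω => (X i ω, Y i ω)) (hindep.precomp Fin.val_injective) (fun i => hlaw i) hFm hFb
    (by positivity) (ε := δ / 2) (by positivity)
  rw [Fintype.card_fin] at hconc
  refine (measure_mono ?_).trans (hconc.trans (ENNReal.ofReal_le_ofReal ?_))
  · rintro ω ⟨i, hi⟩
    refine ⟨i, ?_⟩
    by_contra! hlt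
    refine absurd hi (not_lt.2 ?_)
    set G := ∫ z, F (X i ω, Y i ω) z ∂(labelledMixture α f) with hG
    have hsum : ∑ j, weightMatrix s (fun i : Fin N => X i ω) i j * φ (X j ω, Y j ω)
        = ∑ j ∈ Finset.univ.erase i, (F (X i ω, Y i ω) (X j ω, Y j ω) - G) + (N - 1) * G := by
      rw [Finset.sum_sub_distrib, Finset.sum_const, Finset.card_erase_of_mem (Finset.mem_univ i),
        Finset.card_univ, Fintype.card_fin, nsmul_eq_mul, Nat.cast_sub hnk,
        ← Finset.add_sum_erase _ _ (Finset.mem_univ i)]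
      simp only [weightMatrix_apply, if_true, zero_mul, zero_add]
      push_cast
      rw [sub_add_cancel]
      refine Finset.sum_congr rfl fun j hj => ?_
      rw [if_neg (Finset.ne_of_mem_erase hj).symm]
    have hGb : |G| ≤ gaussianPeak d s * b := by
      have := norm_integral_le_of_norm_le_const (μ := labelledMixture α f)
        (f := F (X i ω, Y i ω)) (C := gaussianPeak d s * b) (ae_of_all _ (hFb (X i ω, Y i ω)))
      simpa using this
    have hGq : |G - q (X i ω)| ≤ K * (s * 2 ^ ((d : ℝ) / 2)) := by
      rw [hG, hFint]
      exact abs_integral_gaussianKernel_mul_sub_le hσk hK hqint _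
    set T := ∑ j ∈ Finset.univ.erase i, (F (X i ω, Y i ω) (X j ω, Y j ω) - G) with hT
    have hdecomp : 1 / (N : ℝ) * (T + (N - 1) * G) - q (X i ω)
        = T / N + (G - q (X i ω)) - G / N := by
      field_simp
      ring
    have hT' : |T / N| ≤ δ / 2 := by
      rw [abs_div, abs_of_pos hN0, div_le_iff₀ hN0]
      exact hlt.le
    have hGN : |G / N| ≤ b * (gaussianPeak d s / N) := by
      rw [abs_div, abs_of_pos hN0, ← mul_div_assoc, mul_comm b]
      gcongr
    rw [hsum, hdecomp]
    have h1 := abs_sub (T / N + (G - q (X i ω))) (G / N)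
    have h2 := abs_add_le (T / N) (G - q (X i ω))
    linarith
  · gcongr
    rw [neg_div, neg_le_neg_iff, mul_pow]
    have h2 : gaussianPeak d s ^ 2 ≤ √(N : ℝ) := Real.le_sqrt_of_sq_le (by
      linarith [(by ring : (gaussianPeak d s ^ 2) ^ 2 = gaussianPeak d s ^ 4)])
    rw [div_mul_eq_mul_div, div_le_div_iff₀ (by positivity) (by positivity)]
    have h3 : √(N : ℝ) * gaussianPeak d s ^ 2 ≤ N := by
      calc _ ≤ √(N : ℝ) * √(N : ℝ) := by gcongr
        _ = N := Real.mul_self_sqrt hN0.le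
    have h4 : 0 ≤ (δ / 2) ^ 2 * (2 * b ^ 2) := by positivity
    calc _ = (δ / 2) ^ 2 * (2 * b ^ 2) * (√(N : ℝ) * gaussianPeak d s ^ 2) := by ring
      _ ≤ (δ / 2) ^ 2 * (2 * b ^ 2) * N := by gcongr
      _ = _ := by ring

/-- The weak law of large numbers for a bounded function of the labelled points. -/
theorem tendsto_measure_lt_abs_average_sub
    (hlaw : ∀ i, HasLaw (fun ω => (X i ω, Y i ω)) (labelledMixture α f) μ)
    (hindep : iIndepFun (fun i ω => (X i ω, Y i ω)) μ)
    {φ : EuclideanSpace ℝ (Fin d) × ι → ℝ} (hφ : Measurable φ) {b : ℝ} (hb0 : 0 < b)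
    (hb : ∀ z, |φ z| ≤ b) {κ : Type*} {l : Filter κ} {n : κ → ℕ}
    (hn : Tendsto n l atTop) {δ : ℝ} (hδ : 0 < δ) :
    Tendsto (fun k => μ {ω | δ * n k ≤ |∑ j : Fin (n k),
      (φ (X j ω, Y j ω) - ∫ z, φ z ∂(labelledMixture α f))|}) l (𝓝 0) := by
  have hmaj : Tendsto (fun k => ENNReal.ofReal
      (2 * Real.exp (-(δ ^ 2 * n k) / (2 * b ^ 2)))) l (𝓝 0) := by
    have h1 : Tendsto (fun k => δ ^ 2 / (2 * b ^ 2) * (n k : ℝ)) l atTop :=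
      (tendsto_natCast_atTop_atTop.comp hn).const_mul_atTop (by positivity)
    have h2 := (Real.tendsto_exp_neg_atTop_nhds_zero.comp h1).const_mul 2
    have h3 := ENNReal.tendsto_ofReal h2
    simp only [mul_zero, ENNReal.ofReal_zero] at h3
    refine h3.congr fun k => ?_
    simp only [Function.comp_apply]
    congr 3
    ring
  refine tendsto_of_tendsto_of_tendsto_of_le_of_le tendsto_const_nhds hmaj
    (fun _ => zero_le) fun k => ?_
  have h := measure_le_abs_average_sub_le (V := Fin (n k)) (Z := fun i ω => (X i ω, Y i ω))
    (hindep.precomp Fin.val_injective) (fun i => hlaw i) hφ hb hb0 hδ.le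
  rwa [Fintype.card_fin] at h

end Averages

/-! ### Consequences of the rates -/

section Rates

variable {d : ℕ} {κ : Type*} {l : Filter κ} {n m : κ → ℕ} {σ : κ → ℝ}

theorem rpow_two_pi_mul_sq {σ : ℝ} (hσ : 0 < σ) :
    (2 * Real.pi * σ ^ 2) ^ ((d : ℝ) / 2) = (2 * Real.pi) ^ ((d : ℝ) / 2) * σ ^ d := by
  rw [Real.mul_rpow (by positivity) (by positivity)]
  congr 1
  rw [← Real.rpow_natCast σ 2, ← Real.rpow_mul hσ.le, ← Real.rpow_natCast σ d]
  congr 1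
  push_cast
  ring

theorem two_mul_gaussianPeak {σ : ℝ} (hσ : 0 < σ) :
    2 * gaussianPeak d σ = rateConst d / σ ^ d := by
  rw [gaussianPeak, rateConst, rpow_two_pi_mul_sq hσ]
  field_simp

theorem gaussianPeak_le_inv_pow {σ : ℝ} (hσ : 0 < σ) : gaussianPeak d σ ≤ σ⁻¹ ^ d := by
  rw [gaussianPeak, rpow_two_pi_mul_sq hσ, inv_pow, ← one_div]
  have h1 : (1 : ℝ) ≤ (2 * Real.pi) ^ ((d : ℝ) / 2) :=
    Real.one_le_rpow (by linarith [Real.pi_gt_three]) (by positivity)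
  have h2 : 0 < σ ^ d := by positivity
  exact one_div_le_one_div_of_le h2 (le_mul_of_one_le_left h2.le h1)

theorem tendsto_gaussianPeak_atTop (hd : 0 < d) (hσ : Tendsto σ l (𝓝[>] 0)) :
    Tendsto (fun k => 2 * gaussianPeak d (σ k)) l atTop := by
  have h1 : Tendsto (fun k => rateConst d * (σ k)⁻¹ ^ d) l atTop :=
    ((tendsto_pow_atTop hd.ne').comp (tendsto_inv_nhdsGT_zero.comp hσ)).const_mul_atTop
      (by unfold rateConst; positivity)
  refine h1.congr' ?_
  filter_upwards [hσ.eventually self_mem_nhdsWithin] with k hk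
  rw [two_mul_gaussianPeak hk, inv_pow, div_eq_mul_inv]

/-- The first rate makes `n` larger than `(2 (2πσ²)^{-d/2})^m`, hence than any fixed power of the
maximum of the kernel. -/
theorem eventually_gaussianPeak_pow_le (hd : 0 < d) (hσ : Tendsto σ l (𝓝[>] 0))
    (hm : Tendsto m l atTop)
    (hrate₁ : Tendsto
      (fun k => (n k : ℝ) * σ k ^ (m k * d) / ((m k : ℝ) ^ 2 * rateConst d ^ m k)) l atTop) :
    ∀ᶠ k in l, gaussianPeak d (σ k) ^ 4 ≤ n k := by
  filter_upwards [hσ.eventually self_mem_nhdsWithin, hm.eventually_ge_atTop 4,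
    hrate₁.eventually_ge_atTop 1, (tendsto_gaussianPeak_atTop hd hσ).eventually_ge_atTop 1]
    with k hk hmk hrk hpk
  have hσk : 0 < σ k := hk
  have hC : 0 < rateConst d := by unfold rateConst; positivity
  have hm1 : (1 : ℝ) ≤ m k := by exact_mod_cast (by omega : 1 ≤ m k)
  rw [le_div_iff₀ (by positivity), one_mul] at hrk
  have h1 : (2 * gaussianPeak d (σ k)) ^ m k ≤ n k := by
    rw [two_mul_gaussianPeak hσk, div_pow, ← pow_mul, mul_comm d, div_le_iff₀ (by positivity)]
    refine le_trans ?_ hrk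
    exact le_mul_of_one_le_left (by positivity) (one_le_pow₀ hm1)
  have h2 := gaussianPeak_nonneg d (σ k)
  calc gaussianPeak d (σ k) ^ 4 ≤ (2 * gaussianPeak d (σ k)) ^ 4 := by gcongr; linarith
    _ ≤ (2 * gaussianPeak d (σ k)) ^ m k := pow_le_pow_right₀ hpk hmk
    _ ≤ n k := h1

theorem eventually_le_log_inv (hσ : Tendsto σ l (𝓝[>] 0)) (hm : Tendsto m l atTop)
    (hrate₂ : Tendsto (fun k => (m k : ℝ) * 2 ^ m k * σ k ^ 2) l (𝓝 0)) :
    ∀ᶠ k in l, (m k : ℝ) ≤ 4 * Real.log (σ k)⁻¹ := by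
  filter_upwards [hσ.eventually self_mem_nhdsWithin, hm.eventually_ge_atTop 1,
    hrate₂.eventually_le_const zero_lt_one] with k hk hmk hrk
  have hσk : 0 < σ k := hk
  have hm1 : (1 : ℝ) ≤ m k := by exact_mod_cast hmk
  have h1 : (2 : ℝ) ^ m k ≤ (σ k)⁻¹ ^ 2 := by
    rw [inv_pow, ← one_div, le_div_iff₀ (by positivity)]
    refine le_trans ?_ hrk
    rw [mul_assoc]
    exact le_mul_of_one_le_left (by positivity) hm1
  have h2 := Real.log_le_log (by positivity) h1
  rw [Real.log_pow, Real.log_pow] at h2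
  have h3 : (m k : ℝ) * (1 / 2) ≤ m k * Real.log 2 := by
    gcongr
    linarith [Real.log_two_gt_d9]
  push_cast at h2
  linarith

theorem eventually_mul_log_sq_le (hσ : Tendsto σ l (𝓝[>] 0)) {C : ℝ} (hC : 0 < C) :
    ∀ᶠ k in l, C * Real.log (σ k)⁻¹ ^ 2 ≤ (σ k)⁻¹ := by
  have h1 := (Real.isLittleO_pow_log_id_atTop (n := 2)).bound (inv_pos.2 hC)
  have h2 : Tendsto (fun k => (σ k)⁻¹) l atTop := tendsto_inv_nhdsGT_zero.comp hσ
  filter_upwards [h2.eventually h1, hσ.eventually self_mem_nhdsWithin] with k hk hσk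
  have hσk : 0 < σ k := hσk
  rw [Real.norm_of_nonneg (sq_nonneg _), id, Real.norm_of_nonneg (by positivity),
    ← div_eq_inv_mul, le_div_iff₀ hC] at hk
  linarith

theorem eventually_mul_sqrt_le (hσ : Tendsto σ l (𝓝[>] 0)) (hm : Tendsto m l atTop)
    (hrate₂ : Tendsto (fun k => (m k : ℝ) * 2 ^ m k * σ k ^ 2) l (𝓝 0)) {ε : ℝ} (hε : 0 < ε) :
    ∀ᶠ k in l, ((m k : ℝ) + 1) * √(σ k) ≤ ε := by
  filter_upwards [hσ.eventually self_mem_nhdsWithin, hm.eventually_ge_atTop 1,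
    eventually_le_log_inv hσ hm hrate₂,
    eventually_mul_log_sq_le hσ (C := 64 / ε ^ 2) (by positivity)] with k hk hmk hlog hsq
  have hσk : 0 < σ k := hk
  have hm1 : (1 : ℝ) ≤ m k := by exact_mod_cast hmk
  refine (pow_le_pow_iff_left₀ (by positivity) hε.le two_ne_zero).1 ?_
  rw [mul_pow, Real.sq_sqrt hσk.le]
  have h1 : ((m k : ℝ) + 1) ^ 2 ≤ 64 * Real.log (σ k)⁻¹ ^ 2 := by
    calc ((m k : ℝ) + 1) ^ 2 ≤ (8 * Real.log (σ k)⁻¹) ^ 2 := by gcongr; linarith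
      _ = _ := by ring
  have h2 : 64 * Real.log (σ k)⁻¹ ^ 2 ≤ ε ^ 2 * (σ k)⁻¹ := by
    calc _ = ε ^ 2 * (64 / ε ^ 2 * Real.log (σ k)⁻¹ ^ 2) := by field_simp
      _ ≤ _ := by gcongr
  calc ((m k : ℝ) + 1) ^ 2 * σ k ≤ ε ^ 2 * (σ k)⁻¹ * σ k := by gcongr; exact h1.trans h2
    _ = ε ^ 2 := by field_simp

/-- The second rate makes `m` at most logarithmic in `1 / σ`, so `e^{-1/(2σ)}`, the relative size of
the kernel at distance `√σ`, beats the factors `(2 (2πσ²)^{-d/2})^m`. -/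
theorem eventually_tail_le (hσ : Tendsto σ l (𝓝[>] 0)) (hm : Tendsto m l atTop)
    (hrate₂ : Tendsto (fun k => (m k : ℝ) * 2 ^ m k * σ k ^ 2) l (𝓝 0)) {ε : ℝ} (hε : 0 < ε) :
    ∀ᶠ k in l, m k * (2 * gaussianPeak d (σ k)) ^ m k
      * Real.exp (-√(σ k) ^ 2 / (2 * σ k ^ 2)) ≤ ε ^ m k := by
  have hinv : Tendsto (fun k => (σ k)⁻¹) l atTop := tendsto_inv_nhdsGT_zero.comp hσ
  filter_upwards [hσ.eventually self_mem_nhdsWithin, eventually_le_log_inv hσ hm hrate₂,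
    eventually_mul_log_sq_le hσ (C := 8 * ((d : ℝ) + 1)) (by positivity),
    hinv.eventually_ge_atTop (4 / ε)] with k hk hlog hsq hx
  have hσk : 0 < σ k := hk
  set x := (σ k)⁻¹ with hxdef
  have hx0 : 0 < x := by positivity
  have hL0 : 0 ≤ Real.log x := by
    have : (0 : ℝ) ≤ m k := Nat.cast_nonneg _
    linarith
  have hpk := gaussianPeak_nonneg d (σ k)
  have hexp : -√(σ k) ^ 2 / (2 * σ k ^ 2) = -(x / 2) := by
    rw [Real.sq_sqrt hσk.le, hxdef]
    field_simp
  have h1 : 4 * gaussianPeak d (σ k) ≤ ε * x ^ (d + 1) := by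
    rw [div_le_iff₀ hε] at hx
    calc 4 * gaussianPeak d (σ k) ≤ (x * ε) * x ^ d :=
          mul_le_mul hx (gaussianPeak_le_inv_pow hσk) hpk (by positivity)
      _ = _ := by ring
  have h2 : (m k : ℝ) ≤ 2 ^ m k := by exact_mod_cast Nat.lt_two_pow_self.le
  have h3 : x ^ ((d + 1) * m k) ≤ Real.exp (x / 2) := by
    rw [← Real.exp_log (pow_pos hx0 ((d + 1) * m k)), Real.log_pow]
    refine Real.exp_le_exp.2 ?_
    push_cast
    calc ((d : ℝ) + 1) * m k * Real.log x ≤ ((d : ℝ) + 1) * (4 * Real.log x) * Real.log x := by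
          gcongr
      _ = (8 * ((d : ℝ) + 1) * Real.log x ^ 2) / 2 := by ring
      _ ≤ x / 2 := by gcongr
  rw [hexp]
  calc m k * (2 * gaussianPeak d (σ k)) ^ m k * Real.exp (-(x / 2))
      ≤ 2 ^ m k * (2 * gaussianPeak d (σ k)) ^ m k * Real.exp (-(x / 2)) := by gcongr
    _ = (4 * gaussianPeak d (σ k)) ^ m k * Real.exp (-(x / 2)) := by rw [← mul_pow]; ring_nf
    _ ≤ (ε * x ^ (d + 1)) ^ m k * Real.exp (-(x / 2)) := by gcongr
    _ = ε ^ m k * (x ^ ((d + 1) * m k) * Real.exp (-(x / 2))) := by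
        rw [mul_pow, ← pow_mul]; ring
    _ ≤ ε ^ m k * (Real.exp (x / 2) * Real.exp (-(x / 2))) := by gcongr
    _ = ε ^ m k := by rw [← Real.exp_add]; simp

end Rates

/-! ### The two bounds in probability -/

section Bounds

variable {d : ℕ} {ι : Type*} [Fintype ι] [DecidableEq ι] [MeasurableSpace ι]
  {α : ι → ℝ} {f : ι → EuclideanSpace ℝ (Fin d) → ℝ} {A : ι}
  {Ω : Type*} [MeasurableSpace Ω] {μ : Measure Ω} [IsProbabilityMeasure μ]
  {X : ℕ → Ω → EuclideanSpace ℝ (Fin d)} {Y : ℕ → Ω → ι}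
  {κ : Type*} {l : Filter κ} {n m : κ → ℕ} {σ : κ → ℝ}

theorem bandwidthEstimate_nonneg {N : ℕ} (s : ℝ) (x : Fin N → EuclideanSpace ℝ (Fin d)) (k : ℕ)
    (g : Fin N → ℝ) : 0 ≤ bandwidthEstimate (graphLaplacian s x) k g := by
  refine Real.rpow_nonneg (div_nonneg
    ((posSemidef_graphLaplacian s x).dotProduct_pow_mulVec_nonneg g k) ?_) _
  rw [← norm_toLp_sq]
  positivity

/-- The normalised degrees converge to the density, uniformly over the data points. -/
theorem tendsto_measure_degree_deviation (hα : ∀ i, 0 ≤ α i)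
    (hf : ∀ i, IsRegularDensity (f i)) (hA : α A < 1)
    (hlaw : ∀ i, HasLaw (fun ω => (X i ω, Y i ω)) (labelledMixture α f) μ)
    (hindep : iIndepFun (fun i ω => (X i ω, Y i ω)) μ)
    (hn : Tendsto n l atTop) (hσ : Tendsto σ l (𝓝[>] 0))
    (hpeak : ∀ᶠ k in l, gaussianPeak d (σ k) ^ 4 ≤ n k) {δ : ℝ} (hδ : 0 < δ) :
    Tendsto (fun k => μ {ω | ∃ i : Fin (n k), δ < |1 / (n k : ℝ) *
      ∑ j, weightMatrix (σ k) (fun i : Fin (n k) => X i ω) i j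
        - mixtureDensity α f A (X i ω)|}) l (𝓝 0) := by
  obtain ⟨K, hK⟩ := exists_lipschitzWith_mixtureDensity (α := α) hf hA
  have h := tendsto_measure_exists_lt_abs_weighted_average_sub hα hf hlaw hindep (φ := fun _ => 1)
    measurable_const one_pos (by simp) (by simpa using mixtureDensity_eq_sum hA) hK
    (integrable_mixtureDensity hf hA) hn hσ hpeak hδ
  simpa only [mul_one] using h

variable [MeasurableSingletonClass ι]

theorem tendsto_measure_lt_bandwidthEstimate (hα : ∀ i, 0 ≤ α i)
    (hf : ∀ i, IsRegularDensity (f i)) (hA : α A < 1)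
    (hlaw : ∀ i, HasLaw (fun ω => (X i ω, Y i ω)) (labelledMixture α f) μ)
    (hindep : iIndepFun (fun i ω => (X i ω, Y i ω)) μ)
    (hn : Tendsto n l atTop) (hσ : Tendsto σ l (𝓝[>] 0)) (hm : Tendsto m l atTop)
    (hpeak : ∀ᶠ k in l, gaussianPeak d (σ k) ^ 4 ≤ n k)
    (hrate₂ : Tendsto (fun k => (m k : ℝ) * 2 ^ m k * σ k ^ 2) l (𝓝 0)) {ε : ℝ} (hε : 0 < ε) :
    Tendsto (fun k => μ {ω | sSup (mixtureDensity α f A '' overlapRegion α f A) + ε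
      < bandwidthEstimate (graphLaplacian (σ k) fun i : Fin (n k) => X i ω) (m k)
        (classIndicator A fun i : Fin (n k) => Y i ω)}) l (𝓝 0) := by
  obtain ⟨K, hK⟩ := exists_lipschitzWith_mixtureDensity (α := α) hf hA
  set s := sSup (mixtureDensity α f A '' overlapRegion α f A) with hs
  have hs0 : 0 ≤ s := by
    refine Real.sSup_nonneg ?_
    rintro _ ⟨w, -, rfl⟩
    exact mixtureDensity_nonneg hα hf hA w
  have hae : ∀ᵐ ω ∂μ, ∀ i, 0 < α (Y i ω) * f (Y i ω) (X i ω) := by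
    refine ae_all_iff.2 fun i => ?_
    have h := ae_labelledMixture_pos (α := α) hf
    rw [← (hlaw i).map_eq] at h
    exact ae_of_ae_map (hlaw i).aemeasurable h
  have hdev := tendsto_measure_degree_deviation (A := A) hα hf hA hlaw hindep hn hσ hpeak
    (δ := ε / 4) (by positivity)
  have hK1 : (0 : ℝ) < K + 1 := by positivity
  refine tendsto_of_tendsto_of_tendsto_of_le_of_le' tendsto_const_nhds hdev
    (Eventually.of_forall fun _ => zero_le) ?_
  filter_upwards [hσ.eventually self_mem_nhdsWithin, hm.eventually_ge_atTop 1,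
    (tendsto_gaussianPeak_div hn hpeak).eventually_le_const (by positivity : 0 < ε / 4),
    eventually_mul_sqrt_le hσ hm hrate₂ (ε := ε / 4 / (K + 1)) (by positivity),
    eventually_tail_le (d := d) hσ hm hrate₂ (ε := ε / 4) (by positivity)]
    with k hσk hmk hpk hsq htail
  refine measure_mono_ae ?_
  filter_upwards [hae] with ω hω hlt
  by_contra hdeg
  have hdeg' : ∀ i : Fin (n k), |1 / (n k : ℝ) *
      ∑ j, weightMatrix (σ k) (fun i : Fin (n k) => X i ω) i j
        - mixtureDensity α f A (X i ω)| ≤ ε / 4 := by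
    intro i
    by_contra! h
    exact hdeg ⟨i, h⟩
  have hclass : ∀ i, if Y i ω = A then 0 < f A (X i ω) else 0 < complDensity α f A (X i ω) := by
    intro i
    have h1 := hω i
    split_ifs with h
    · rw [h] at h1
      exact pos_of_mul_pos_right h1 (hα A)
    · refine div_pos (h1.trans_le ?_) (by linarith)
      exact Finset.single_le_sum (f := fun j => α j * f j (X i ω))
        (fun j _ => mul_nonneg (hα j) ((hf j).nonneg _))
        (Finset.mem_erase.2 ⟨h, Finset.mem_univ _⟩)
  have hle := bandwidthEstimate_le (σ := σ k) (r := √(σ k)) hσk (Real.sqrt_nonneg _)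
    (x := fun i : Fin (n k) => X i ω) hK (by positivity : 0 ≤ ε / 4) hs0
    (fun i => by linarith [(abs_le.1 (hdeg' i)).2])
    (g := classIndicator A fun i : Fin (n k) => Y i ω) (fun i j hij hr => by
      have hi := hclass i
      have hj := hclass j
      simp only [classIndicator] at hij
      by_cases h1 : Y i ω = A <;> by_cases h2 : Y j ω = A
      · simp [h1, h2] at hij
      · rw [if_pos h1] at hi
        rw [if_neg h2] at hj
        exact (mixtureDensity_le_of_norm_sub_le hα hf hA hK hr hi hj).1
      · rw [if_neg h1] at hi
        rw [if_pos h2] at hj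
        rw [norm_sub_rev] at hr
        exact (mixtureDensity_le_of_norm_sub_le hα hf hA hK hr hj hi).2
      · simp [h1, h2] at hij)
    hmk (by positivity : 0 ≤ ε / 4) htail
  have h3 : (K : ℝ) * (((m k : ℝ) + 1) * √(σ k)) ≤ ε / 4 := by
    rw [le_div_iff₀ hK1] at hsq
    have : 0 ≤ ((m k : ℝ) + 1) * √(σ k) := by positivity
    linarith
  have hlt' : s + ε < bandwidthEstimate (graphLaplacian (σ k) fun i : Fin (n k) => X i ω) (m k)
        (classIndicator A fun i : Fin (n k) => Y i ω) := hlt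
  linarith

/-- Where `p` exceeds a level below its supremum over the overlap region, labels are still random:
the class `A` keeps a positive mass of `1 - a` there, with `a` the conditional class probability. -/
theorem integral_pos_of_lt_sSup (hα : ∀ i, 0 ≤ α i) (hf : ∀ i, IsRegularDensity (f i))
    (hA₀ : 0 < α A) (hA : α A < 1) {t : ℝ} (ht : 0 ≤ t)
    (hts : t < sSup (mixtureDensity α f A '' overlapRegion α f A)) :
    0 < ∫ z, (if z.2 = A ∧ t < mixtureDensity α f A z.1 then 1 - classPosterior α f A z.1 else 0)
      ∂(labelledMixture α f) := by
  have hpm : Measurable (mixtureDensity α f A) := (continuous_mixtureDensity hf).measurable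
  have ham : Measurable (classPosterior α f A) := measurable_classPosterior hf
  set h : EuclideanSpace ℝ (Fin d) → ℝ := fun x =>
    if t < mixtureDensity α f A x then 1 - classPosterior α f A x else 0 with hh
  have hhm : Measurable h :=
    Measurable.ite (measurableSet_lt measurable_const hpm) (measurable_const.sub ham)
      measurable_const
  have hh0 : ∀ x, 0 ≤ h x := by
    intro x
    simp only [hh]
    split_ifs
    · linarith [classPosterior_le_one (A := A) hα hf hA x]
    · exact le_rfl
  have hh1 : ∀ x, h x ≤ 1 := by
    intro x
    simp only [hh]
    split_ifs
    · linarith [classPosterior_nonneg (A := A) hα hf hA x]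
    · exact zero_le_one
  have heq : ∀ z : EuclideanSpace ℝ (Fin d) × ι,
      (if z.2 = A ∧ t < mixtureDensity α f A z.1 then 1 - classPosterior α f A z.1 else 0)
        = if z.2 = A then h z.1 else 0 := by
    intro z
    simp only [hh, ite_and]
  simp only [heq]
  rw [integral_labelledMixture hα hf (φ := fun z => if z.2 = A then h z.1 else 0) (b := 1)
    (Measurable.ite (measurable_snd (measurableSet_singleton A)) (hhm.comp measurable_fst)
      measurable_const) (fun z => by
      split_ifs
      · rw [abs_of_nonneg (hh0 _)]; exact hh1 _
      · simp)]
  have hsum : ∀ x, ∑ i, α i * f i x * (if i = A then h x else 0) = α A * f A x * h x := by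
    intro x
    simp
  simp only [hsum]
  have hint : Integrable fun x => α A * f A x * h x := by
    simp only [mul_comm _ (h _)]
    refine ((hf A).integrable.const_mul _).bdd_mul (c := 1) hhm.aestronglyMeasurable
      (ae_of_all _ fun x => ?_)
    rw [Real.norm_of_nonneg (hh0 x)]
    exact hh1 x
  rw [integral_pos_iff_support_of_nonneg
    (fun x => mul_nonneg (mul_nonneg hA₀.le ((hf A).nonneg x)) (hh0 x)) hint]
  set U := overlapRegion α f A ∩ {x | t < mixtureDensity α f A x} with hU
  have hUo : IsOpen U := by
    refine IsOpen.inter ?_ (isOpen_lt continuous_const (continuous_mixtureDensity hf))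
    exact isOpen_lt continuous_const ((hf A).continuous.mul (continuous_complDensity hf))
  have hUne : U.Nonempty := by
    have hne : (mixtureDensity α f A '' overlapRegion α f A).Nonempty := by
      by_contra hemp
      rw [Set.not_nonempty_iff_eq_empty.1 hemp, Real.sSup_empty] at hts
      linarith
    obtain ⟨_, ⟨x, hx, rfl⟩, hlt⟩ := exists_lt_of_lt_csSup hne hts
    exact ⟨x, hx, hlt⟩
  refine (hUo.measure_pos volume hUne).trans_le (measure_mono ?_)
  rintro x ⟨hx, hxt⟩
  have hx' : 0 < f A x * complDensity α f A x := hx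
  have hfx : 0 < f A x := pos_of_mul_pos_left hx' (complDensity_nonneg hα hf hA x)
  have hcx : 0 < complDensity α f A x := pos_of_mul_pos_right hx' hfx.le
  have hpx : α A * f A x < mixtureDensity α f A x := by
    rw [mixtureDensity]
    have : 0 < (1 - α A) * complDensity α f A x := mul_pos (by linarith) hcx
    linarith
  have hax : classPosterior α f A x < 1 := by
    rw [classPosterior, div_lt_one (lt_of_le_of_lt (by positivity) hpx)]
    exact hpx
  have hhx : 0 < h x := by
    simp only [hh]
    rw [if_pos (show t < mixtureDensity α f A x from hxt)]
    linarith
  exact (by positivity : 0 < α A * f A x * h x).ne'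

theorem tendsto_measure_bandwidthEstimate_lt (hα : ∀ i, 0 ≤ α i)
    (hf : ∀ i, IsRegularDensity (f i)) (hA₀ : 0 < α A) (hA : α A < 1)
    (hlaw : ∀ i, HasLaw (fun ω => (X i ω, Y i ω)) (labelledMixture α f) μ)
    (hindep : iIndepFun (fun i ω => (X i ω, Y i ω)) μ)
    (hn : Tendsto n l atTop) (hσ : Tendsto σ l (𝓝[>] 0)) (hm : Tendsto m l atTop)
    (hpeak : ∀ᶠ k in l, gaussianPeak d (σ k) ^ 4 ≤ n k) {t : ℝ}
    (hts : t < sSup (mixtureDensity α f A '' overlapRegion α f A)) :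
    Tendsto (fun k => μ {ω | bandwidthEstimate (graphLaplacian (σ k) fun i : Fin (n k) => X i ω)
      (m k) (classIndicator A fun i : Fin (n k) => Y i ω) < t}) l (𝓝 0) := by
  rcases le_or_gt t 0 with ht0 | ht0
  · have hempty : ∀ k, {ω | bandwidthEstimate (graphLaplacian (σ k) fun i : Fin (n k) => X i ω)
        (m k) (classIndicator A fun i : Fin (n k) => Y i ω) < t} = ∅ := by
      intro k
      ext ω
      simp only [Set.mem_ofPred_eq, Set.mem_empty_iff_false, iff_false, not_lt]
      exact ht0.trans (bandwidthEstimate_nonneg _ _ _ _)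
    simp only [hempty, measure_empty]
    exact tendsto_const_nhds
  obtain ⟨t', htt', ht's⟩ := exists_between hts
  have ht'0 : 0 < t' := ht0.trans htt'
  set p := mixtureDensity α f A with hp
  set a := classPosterior α f A with ha
  have hp0 : ∀ x, 0 ≤ p x := mixtureDensity_nonneg hα hf hA
  have ha0 : ∀ x, 0 ≤ a x := classPosterior_nonneg hα hf hA
  have ha1 : ∀ x, a x ≤ 1 := classPosterior_le_one hα hf hA
  have hpa : ∀ x, p x * a x = α A * f A x := mixtureDensity_mul_classPosterior hα hf hA
  have hpm : Measurable p := (continuous_mixtureDensity hf).measurable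
  have ham : Measurable a := measurable_classPosterior hf
  obtain ⟨B, hB⟩ := exists_mixtureDensity_le (A := A) hα hf hA
  set ψ : EuclideanSpace ℝ (Fin d) × ι → ℝ := fun z =>
    if z.2 = A ∧ t' < p z.1 then 1 - a z.1 else 0 with hψ
  have hψm : Measurable ψ :=
    Measurable.ite ((measurable_snd (measurableSet_singleton A)).inter
      (measurableSet_lt measurable_const (hpm.comp measurable_fst)))
      (measurable_const.sub (ham.comp measurable_fst)) measurable_const
  have hψ1 : ∀ z, |ψ z| ≤ 1 := by
    intro z
    simp only [hψ]
    split_ifs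
    · rw [abs_le]; constructor <;> linarith [ha0 z.1, ha1 z.1]
    · simp
  set c := ∫ z, ψ z ∂(labelledMixture α f) with hc
  have hc0 : 0 < c := integral_pos_of_lt_sSup hα hf hA₀ hA ht'0.le ht's
  -- The mass `c` does not depend on the order `M`, so a high power of `t' / t` absorbs it.
  obtain ⟨M, hM0, hM⟩ : ∃ M : ℕ, 0 < M ∧ 2 * t ^ M ≤ t' ^ M * (c / 2) := by
    have h1 : Tendsto (fun M : ℕ => (t' / t) ^ M) atTop atTop :=
      tendsto_pow_atTop_atTop_of_one_lt ((one_lt_div ht0).2 htt')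
    obtain ⟨M, hM1, hM2⟩ := ((h1.eventually_ge_atTop (4 / c)).and (eventually_gt_atTop 0)).exists
    refine ⟨M, hM2, ?_⟩
    rw [div_pow, div_le_div_iff₀ hc0 (by positivity)] at hM1
    linarith
  set R : ℝ := |B| + 2 with hR
  have hR1 : 1 ≤ R := by linarith [abs_nonneg B]
  have hM0' : (0 : ℝ) < M := by exact_mod_cast hM0
  set δ : ℝ := min 1 (t ^ M / (2 * M * R ^ M)) with hδ
  have hδ0 : 0 < δ := lt_min one_pos (by positivity)
  have hδ1 : δ ≤ 1 := min_le_left _ _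
  have hδM : 2 * M * δ * R ^ M ≤ t ^ M := by
    have h1 : δ ≤ t ^ M / (2 * M * R ^ M) := min_le_right _ _
    rw [le_div_iff₀ (by positivity)] at h1
    linarith
  have hpos : ∀ᶠ k in l, 0 < σ k := hσ.eventually self_mem_nhdsWithin
  have h1 := tendsto_measure_degree_deviation (A := A) hα hf hA hlaw hindep hn hσ hpeak hδ0
  have h2 : Tendsto (fun k => μ {ω | ∃ i : Fin (n k), δ < |1 / (n k : ℝ) *
      ∑ j, weightMatrix (σ k) (fun i : Fin (n k) => X i ω) i j *
        (if Y j ω = A then 1 else 0) - p (X i ω) * a (X i ω)|}) l (𝓝 0) := by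
    obtain ⟨K, hK⟩ := exists_lipschitzWith_const_mul (hf A) (α A)
    refine tendsto_measure_exists_lt_abs_weighted_average_sub hα hf hlaw hindep
      (φ := fun z => if z.2 = A then 1 else 0) (q := fun x => p x * a x) ?_ one_pos ?_ ?_
      (K := K) ?_ ?_ hn hσ hpeak hδ0
    · exact Measurable.ite (measurable_snd (measurableSet_singleton A)) measurable_const
        measurable_const
    · intro z; split_ifs <;> simp
    · intro x; simp [hpa]
    · simpa only [hpa] using hK
    · simpa only [hpa] using (hf A).integrable.const_mul (α A)
  have h3 : ∀ r : ℕ, Tendsto (fun k => μ {ω | ∃ i : Fin (n k), δ < |1 / (n k : ℝ) *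
      ∑ j, weightMatrix (σ k) (fun i : Fin (n k) => X i ω) i j *
        (p (X j ω) ^ r * ((if Y j ω = A then 1 else 0) - a (X j ω)))|}) l (𝓝 0) := by
    intro r
    have h := tendsto_measure_exists_lt_abs_weighted_average_sub hα hf hlaw hindep
      (φ := fun z => p z.1 ^ r * ((if z.2 = A then 1 else 0) - a z.1)) (q := fun _ => 0)
      (b := R ^ r) ?_ (by positivity) ?_ ?_ (K := 0) (LipschitzWith.const 0)
      (integrable_zero _ _ _) hn hσ hpeak hδ0
    · simpa only [sub_zero] using h
    · refine ((hpm.comp measurable_fst).pow_const r).mul (Measurable.sub ?_ (ham.comp measurable_fst))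
      exact Measurable.ite (measurable_snd (measurableSet_singleton A)) measurable_const
        measurable_const
    · intro z
      rw [abs_mul, abs_of_nonneg (pow_nonneg (hp0 _) r)]
      have h4 : |(if z.2 = A then (1 : ℝ) else 0) - a z.1| ≤ 1 := by
        split_ifs <;> rw [abs_le] <;> constructor <;> linarith [ha0 z.1, ha1 z.1]
      have h5 : p z.1 ^ r ≤ R ^ r :=
        pow_le_pow_left₀ (hp0 _) (by linarith [hB z.1, le_abs_self B]) r
      exact (mul_le_mul h5 h4 (abs_nonneg _) (by positivity)).trans (by simp)
    · intro x
      -- By the definition of the posterior, the part of the indicator killed by averaging has zero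
      -- mean at every location.
      have h4 : ∑ i, α i * f i x * (p x ^ r * ((if i = A then 1 else 0) - a x))
          = p x ^ r * (α A * f A x - a x * ∑ i, α i * f i x) := by
        have h5 : ∀ i, α i * f i x * (p x ^ r * ((if i = A then 1 else 0) - a x))
            = p x ^ r * (if i = A then α i * f i x else 0) - p x ^ r * (a x * (α i * f i x)) := by
          intro i
          split_ifs <;> ring
        simp only [h5, Finset.sum_sub_distrib, ← Finset.mul_sum, Finset.sum_ite_eq',
          Finset.mem_univ, if_true]
        ring
      rw [h4, ← mixtureDensity_eq_sum hA, mul_comm (a x), hpa, sub_self, mul_zero]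
  have h4 := tendsto_measure_lt_abs_average_sub hlaw hindep hψm one_pos hψ1 hn
    (half_pos hc0)
  have hsum : Tendsto (fun k => μ {ω | ∃ i : Fin (n k), δ < |1 / (n k : ℝ) *
        ∑ j, weightMatrix (σ k) (fun i : Fin (n k) => X i ω) i j - p (X i ω)|}
      + μ {ω | ∃ i : Fin (n k), δ < |1 / (n k : ℝ) *
        ∑ j, weightMatrix (σ k) (fun i : Fin (n k) => X i ω) i j *
          (if Y j ω = A then 1 else 0) - p (X i ω) * a (X i ω)|}
      + ∑ r ∈ Finset.range M, μ {ω | ∃ i : Fin (n k), δ < |1 / (n k : ℝ) *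
        ∑ j, weightMatrix (σ k) (fun i : Fin (n k) => X i ω) i j *
          (p (X j ω) ^ r * ((if Y j ω = A then 1 else 0) - a (X j ω)))|}
      + μ {ω | c / 2 * n k ≤ |∑ j : Fin (n k), (ψ (X j ω, Y j ω) - c)|}) l (𝓝 0) := by
    have := ((h1.add h2).add (tendsto_finsetSum (Finset.range M) fun r _ => h3 r)).add h4
    simpa using this
  refine tendsto_of_tendsto_of_tendsto_of_le_of_le' tendsto_const_nhds hsum
    (Eventually.of_forall fun _ => zero_le) ?_
  filter_upwards [hpos, hm.eventually_ge_atTop M, hn.eventually_ge_atTop 1,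
    (tendsto_gaussianPeak_div hn hpeak).eventually_le_const one_pos] with k hσk hmk hnk hpk
  refine le_trans (measure_mono ?_) ((measure_union_le _ _).trans (add_le_add
    ((measure_union_le _ _).trans (add_le_add (measure_union_le _ _)
      (measure_biUnion_finset_le (Finset.range M) _))) le_rfl))
  intro ω hω
  by_contra hbad
  simp only [Set.mem_union, Set.mem_iUnion, Set.mem_ofPred_eq, not_or, not_exists, not_lt,
    not_le] at hbad
  obtain ⟨⟨⟨b1, b2⟩, b3⟩, b4⟩ := hbad
  rw [Set.mem_ofPred_eq] at hω
  refine absurd hω (not_lt.2 ?_)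
  have hψsum : (c / 2) * n k ≤ ∑ j : Fin (n k), ψ (X j ω, Y j ω) := by
    have h5 := (abs_lt.1 b4).1
    rw [Finset.sum_sub_distrib, Finset.sum_const, Finset.card_univ, Fintype.card_fin,
      nsmul_eq_mul] at h5
    linarith
  refine le_bandwidthEstimate hσk (p := fun i => p (X i ω)) (a := fun i => a (X i ω))
    (g := classIndicator A fun i : Fin (n k) => Y i ω) hδ0.le hR1 (fun i => hp0 _)
    (fun i => ?_) (fun i => ⟨ha0 _, ha1 _⟩) (fun i => ?_) hM0 b1 b2
    (fun r _ hr i => b3 r (Finset.mem_range.2 hr) i) ht0 hnk ?_ hmk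
  · linarith [hB (X i ω), le_abs_self B]
  · by_cases hy : Y i ω = A <;> simp [classIndicator, hy]
  · have h5 : ∀ i : Fin (n k), t' ^ M * ψ (X i ω, Y i ω)
        ≤ classIndicator A (fun i : Fin (n k) => Y i ω) i * (p (X i ω) ^ M
          * (classIndicator A (fun i : Fin (n k) => Y i ω) i - a (X i ω))) := by
      intro i
      have h6 : 0 ≤ 1 - a (X i ω) := by linarith [ha1 (X i ω)]
      simp only [hψ, classIndicator]
      by_cases hy : Y i ω = A
      · by_cases hx : t' < p (X i ω)
        · rw [if_pos ⟨hy, hx⟩, if_pos hy, one_mul]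
          gcongr
        · rw [if_neg fun h => hx h.2, if_pos hy, one_mul, mul_zero]
          exact mul_nonneg (pow_nonneg (hp0 _) _) h6
      · rw [if_neg fun h => hy h.1, if_neg hy, mul_zero, zero_mul]
    refine le_trans ?_ (Finset.sum_le_sum fun i _ => h5 i)
    rw [← Finset.mul_sum]
    calc (t ^ M + 2 * M * δ * R ^ M) * n k ≤ (t' ^ M * (c / 2)) * n k := by
          gcongr
          linarith
      _ = t' ^ M * ((c / 2) * n k) := by ring
      _ ≤ _ := by gcongr

end Bounds

/-! ### Convergence in probability -/

theorem theorem2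
    {d : ℕ} (hd : 0 < d)
    {ι : Type*} [Fintype ι] [DecidableEq ι] [MeasurableSpace ι] [MeasurableSingletonClass ι]
    (α : ι → ℝ) (hα : ∀ i, 0 ≤ α i) (hαsum : ∑ i, α i = 1)
    (f : ι → EuclideanSpace ℝ (Fin d) → ℝ) (hf : ∀ i, IsRegularDensity (f i))
    (A : ι) (hA₀ : 0 < α A) (hA₁ : α A < 1)
    {Ω : Type*} [MeasurableSpace Ω] (μ : Measure Ω) [IsProbabilityMeasure μ]
    (X : ℕ → Ω → EuclideanSpace ℝ (Fin d)) (Y : ℕ → Ω → ι)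
    (hlaw : ∀ i, HasLaw (fun ω => (X i ω, Y i ω)) (labelledMixture α f) μ)
    (hindep : iIndepFun (fun i ω => (X i ω, Y i ω)) μ)
    {κ : Type*} (l : Filter κ) (n m : κ → ℕ) (σ : κ → ℝ)
    (hn : Tendsto n l atTop) (hσ : Tendsto σ l (𝓝[>] 0)) (hm : Tendsto m l atTop)
    (hrate₁ : Tendsto
      (fun k => (n k : ℝ) * σ k ^ (m k * d) / ((m k : ℝ) ^ 2 * rateConst d ^ m k)) l atTop)
    (hrate₂ : Tendsto (fun k => (m k : ℝ) * 2 ^ m k * σ k ^ 2) l (𝓝 0)) :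
    TendstoInMeasure μ
      (fun k ω => bandwidthEstimate (graphLaplacian (σ k) fun i : Fin (n k) => X i ω) (m k)
        (classIndicator A fun i : Fin (n k) => Y i ω))
      l
      (fun _ => sSup (mixtureDensity α f A '' overlapRegion α f A)) := by
  have hpeak := eventually_gaussianPeak_pow_le hd hσ hm hrate₁
  rw [tendstoInMeasure_iff_norm]
  intro ε hε
  have hupper := tendsto_measure_lt_bandwidthEstimate (A := A) hα hf hA₁ hlaw hindep hn hσ hm hpeak
    hrate₂ (half_pos hε)
  have hlower := tendsto_measure_bandwidthEstimate_lt (A := A) hα hf hA₀ hA₁ hlaw hindep hn hσ hm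
    hpeak (sub_lt_self _ (half_pos hε))
  have hsum := hupper.add hlower
  rw [add_zero] at hsum
  refine tendsto_of_tendsto_of_tendsto_of_le_of_le tendsto_const_nhds hsum (fun _ => zero_le)
    fun k => (measure_mono fun ω hω => ?_).trans (measure_union_le _ _)
  rw [Set.mem_ofPred_eq] at hω
  rcases le_abs.1 hω with h | h
  · refine Or.inl ?_
    rw [Set.mem_ofPred_eq]
    linarith
  · refine Or.inr ?_
    rw [Set.mem_ofPred_eq]
    linarith
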